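/- Let $0<p<1$, let $I\subseteq\mathbb R$ be an interval (bounded or not, possibly $\mathbb R$), and let functions take values in $\mathbb K=\mathbb R$ or $\mathbb K=\mathbb C$. Give $L^p(I)$ the topology of its quasi-norm $\|f\|_p=(\int_I|f|^p)^{1/p}$. For an integer $k\ge 0$ let $W^{k,p}=W^{k,p}(I)$ be the abstract completion of the space of restrictions to $I$ of functions in $C_0^\infty(\mathbb R)$ with respect to the quasi-norm $$\|f\|_{W^{k,p}}=\Bigl(\|f\|_p^p+\|f'\|_p^p+\dots+\|f^{(k)}\|_p^p\Bigr)^{1/p},$$ where all the $L^p$ quasi-norms are taken over $I$. Its elements are thus classes of Cauchy sequences $\{f_j\}$ of such functions, two sequences $\{f_j\}$ and $\{g_j\}$ being identified if $\|f_j-g_j\|_{W^{k,p}}\to0$. Theorem. Let $k\ge1$. The maps $\alpha:W^{k,p}\to L^p(I)$, $\alpha\{f_j\}=\lim_j f_j$ (limit in $L^p(I)$), and $\delta:W^{k,p}\to W^{k-1,p}$, $\delta\{f_j\}=\{f_j'\}$, are well defined, and $$f\mapsto(\alpha f,\delta f),\qquad W^{k,p}\to L^p(I)\oplus W^{k-1,p},$$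 is a linear bijection that is continuous with continuous inverse. Moreover there are linear homeomorphisms $$W^{k,p}\cong \underbrace{L^p(I)\oplus\dots\oplus L^p(I)}_{k+1\ \text{summands}}\cong L^p(I).$$ -/

import Mathlib

open Filter Topology MeasureTheory
open scoped ContDiff ENNReal

noncomputable section

namespace PeetreSobolev

/-! ### The quasi-norm on `L^p` and its triangle inequality, `0 < p < 1` -/

theorem toReal_eLpNorm_rpow_add_le {α E : Type*} [MeasurableSpace α] [NormedAddCommGroup E]
    {μ : Measure α} {p : ℝ} (hp : p ∈ Set.Ioo (0 : ℝ) 1) {f g : α → E}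
    (hf : MemLp f (ENNReal.ofReal p) μ) (hg : MemLp g (ENNReal.ofReal p) μ) :
    (eLpNorm (f + g) (ENNReal.ofReal p) μ).toReal ^ p ≤
      (eLpNorm f (ENNReal.ofReal p) μ).toReal ^ p +
        (eLpNorm g (ENNReal.ofReal p) μ).toReal ^ p := by
  obtain ⟨h0, h1⟩ := hp
  have hne : ENNReal.ofReal p ≠ 0 := by simpa using h0
  have key : ∀ h : α → E, eLpNorm h (ENNReal.ofReal p) μ ^ p = ∫⁻ x, ‖h x‖ₑ ^ p ∂μ := by
    intro h
    rw [eLpNorm_eq_lintegral_rpow_enorm_toReal hne ENNReal.ofReal_ne_top,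
      ENNReal.toReal_ofReal h0.le, ← ENNReal.rpow_mul, one_div, inv_mul_cancel₀ h0.ne',
      ENNReal.rpow_one]
  have hle : eLpNorm (f + g) (ENNReal.ofReal p) μ ^ p ≤
      eLpNorm f (ENNReal.ofReal p) μ ^ p + eLpNorm g (ENNReal.ofReal p) μ ^ p := by
    rw [key, key, key, ← lintegral_add_left' (hf.1.enorm.pow_const p)]
    refine lintegral_mono fun x => ?_
    exact (ENNReal.rpow_le_rpow (enorm_add_le _ _) h0.le).trans
      (ENNReal.rpow_add_le_add_rpow _ _ h0.le h1.le)
  rw [ENNReal.toReal_rpow, ENNReal.toReal_rpow, ENNReal.toReal_rpow, ← ENNReal.toReal_add]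
  · refine ENNReal.toReal_mono ?_ hle
    exact ENNReal.add_ne_top.2 ⟨ENNReal.rpow_ne_top_of_nonneg h0.le hf.2.ne,
      ENNReal.rpow_ne_top_of_nonneg h0.le hg.2.ne⟩
  · exact ENNReal.rpow_ne_top_of_nonneg h0.le hf.2.ne
  · exact ENNReal.rpow_ne_top_of_nonneg h0.le hg.2.ne

/-! ### The space `L^p(I)` -/

/-- The space `L^p(I)` of (classes of) `𝕜`-valued `p`-integrable functions on `I`. It is Mathlib's
`Lp`; the copy serves to give it, for `0 < p < 1`, the topology of its quasi-norm. -/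
def LpSpace (𝕜 : Type*) [RCLike 𝕜] (p : ℝ) (I : Set ℝ) : Type _ :=
  Lp 𝕜 (ENNReal.ofReal p) (volume.restrict I)

section LpSpace

variable (𝕜 : Type*) [RCLike 𝕜] (p : ℝ) (I : Set ℝ)

instance : AddCommGroup (LpSpace 𝕜 p I) :=
  inferInstanceAs (AddCommGroup (Lp 𝕜 (ENNReal.ofReal p) (volume.restrict I)))

instance : Module 𝕜 (LpSpace 𝕜 p I) :=
  inferInstanceAs (Module 𝕜 (Lp 𝕜 (ENNReal.ofReal p) (volume.restrict I)))

variable {𝕜 p I}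

/-- The quasi-norm `‖f‖_p = (∫_I |f|^p)^(1/p)` on `L^p(I)`. -/
def LpSpace.quasiNorm (f : LpSpace 𝕜 p I) : ℝ :=
  Norm.norm (E := Lp 𝕜 (ENNReal.ofReal p) (volume.restrict I)) f

variable (𝕜 p I)

/-- For `0 < p < 1` the space `L^p(I)` carries the topology of its quasi-norm, that is, of the
translation invariant metric `d(f, g) = ‖f - g‖_p ^ p`. So `‖f‖` stands for `‖f‖_p ^ p` here. -/
instance [hp : Fact (p ∈ Set.Ioo (0 : ℝ) 1)] : NormedAddCommGroup (LpSpace 𝕜 p I) :=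
  AddGroupNorm.toNormedAddCommGroup
    { toFun := fun f => f.quasiNorm ^ p
      map_zero' := by
        have : (0 : LpSpace 𝕜 p I).quasiNorm = 0 :=
          Lp.norm_zero (E := 𝕜) (p := ENNReal.ofReal p) (μ := volume.restrict I)
        rw [this, Real.zero_rpow hp.out.1.ne']
      add_le' := fun f g => by
        let f' : Lp 𝕜 (ENNReal.ofReal p) (volume.restrict I) := f
        let g' : Lp 𝕜 (ENNReal.ofReal p) (volume.restrict I) := g
        have h := toReal_eLpNorm_rpow_add_le hp.out (Lp.memLp f') (Lp.memLp g')
        rw [← eLpNorm_congr_ae (Lp.coeFn_add f' g')] at h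
        exact h
      neg' := fun f => by
        have : (-f).quasiNorm = f.quasiNorm :=
          Lp.norm_neg (E := 𝕜) (p := ENNReal.ofReal p) (μ := volume.restrict I) f
        rw [this]
      eq_zero_of_map_eq_zero' := fun f hf => by
        have h0 : f.quasiNorm = 0 := by
          by_contra hne
          have hnn : 0 ≤ f.quasiNorm := ENNReal.toReal_nonneg
          exact (Real.rpow_pos_of_pos (lt_of_le_of_ne hnn (Ne.symm hne)) p).ne' hf
        exact (Lp.norm_eq_zero_iff (E := 𝕜) (p := ENNReal.ofReal p) (μ := volume.restrict I)
          (by simpa using hp.out.1)).1 h0 }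

end LpSpace

/-! ### Test functions and the Sobolev quasi-norm -/

/-- `C_0^∞(ℝ)`: the smooth compactly supported functions `ℝ → 𝕜`. -/
def testFunctions (𝕜 : Type*) [RCLike 𝕜] : Submodule 𝕜 (ℝ → 𝕜) where
  carrier := {f | ContDiff ℝ ∞ f ∧ HasCompactSupport f}
  zero_mem' := ⟨contDiff_const, HasCompactSupport.zero⟩
  add_mem' := fun hf hg => ⟨hf.1.add hg.1, hf.2.add hg.2⟩
  smul_mem' := fun c _ hf => ⟨hf.1.const_smul c, hf.2.smul_left (f := fun _ => c)⟩

/-- `C_0^∞(ℝ)`, to be equipped with the `W^{k,p}(I)` quasi-norm, which only sees the restrictions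
to `I`: functions that agree on `I` are at distance zero, hence equal in the completion. -/
def PreSobolev (𝕜 : Type*) [RCLike 𝕜] (_k : ℕ) (_p : ℝ) (_I : Set ℝ) : Type _ :=
  testFunctions 𝕜

namespace PreSobolev

variable {𝕜 : Type*} [RCLike 𝕜] {k : ℕ} {p : ℝ} {I : Set ℝ}

instance : AddCommGroup (PreSobolev 𝕜 k p I) := inferInstanceAs (AddCommGroup (testFunctions 𝕜))

instance : Module 𝕜 (PreSobolev 𝕜 k p I) := inferInstanceAs (Module 𝕜 (testFunctions 𝕜))

/-- The underlying function on the line. -/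
def toFun (f : PreSobolev 𝕜 k p I) : ℝ → 𝕜 := Subtype.val (p := (· ∈ testFunctions 𝕜)) f

theorem contDiff (f : PreSobolev 𝕜 k p I) : ContDiff ℝ ∞ f.toFun :=
  (Subtype.property (p := (· ∈ testFunctions 𝕜)) f).1

theorem hasCompactSupport (f : PreSobolev 𝕜 k p I) : HasCompactSupport f.toFun :=
  (Subtype.property (p := (· ∈ testFunctions 𝕜)) f).2

theorem deriv_mem (f : PreSobolev 𝕜 k p I) : deriv f.toFun ∈ testFunctions 𝕜 :=
  ⟨(contDiff_infty_iff_deriv.1 f.contDiff).2, f.hasCompactSupport.deriv⟩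

theorem memLp_iteratedDeriv (f : PreSobolev 𝕜 k p I) (i : ℕ) (q : ℝ≥0∞) :
    MemLp (iteratedDeriv i f.toFun) q (volume.restrict I) := by
  have h : ContDiff ℝ ∞ (iteratedDeriv i f.toFun) ∧
      HasCompactSupport (iteratedDeriv i f.toFun) := by
    induction i with
    | zero => simpa using ⟨f.contDiff, f.hasCompactSupport⟩
    | succ i ih =>
      rw [iteratedDeriv_succ]
      exact ⟨(contDiff_infty_iff_deriv.1 ih.1).2, ih.2.deriv⟩
  exact (h.1.continuous.memLp_of_hasCompactSupport h.2).restrict I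

theorem memLp (f : PreSobolev 𝕜 k p I) (q : ℝ≥0∞) : MemLp f.toFun q (volume.restrict I) := by
  simpa using f.memLp_iteratedDeriv 0 q

/-- The Sobolev quasi-norm `(‖f‖_p ^ p + ‖f'‖_p ^ p + ⋯ + ‖f⁽ᵏ⁾‖_p ^ p) ^ (1 / p)` over `I`. -/
def quasiNorm (f : PreSobolev 𝕜 k p I) : ℝ :=
  (∑ i ∈ Finset.range (k + 1),
    (eLpNorm (iteratedDeriv i f.toFun) (ENNReal.ofReal p) (volume.restrict I)).toReal ^ p) ^ (1 / p)

theorem quasiNorm_rpow (hp : 0 < p) (f : PreSobolev 𝕜 k p I) :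
    f.quasiNorm ^ p = ∑ i ∈ Finset.range (k + 1),
      (eLpNorm (iteratedDeriv i f.toFun) (ENNReal.ofReal p) (volume.restrict I)).toReal ^ p := by
  rw [quasiNorm, ← Real.rpow_mul (Finset.sum_nonneg fun i _ => by positivity),
    one_div_mul_cancel hp.ne', Real.rpow_one]

/-- The uniform structure of the Sobolev quasi-norm, given by the translation invariant
pseudometric `d(f, g) = ‖f - g‖_{W^{k,p}} ^ p`. So `‖f‖` stands for `‖f‖_{W^{k,p}} ^ p` here. -/
instance [hp : Fact (p ∈ Set.Ioo (0 : ℝ) 1)] : SeminormedAddCommGroup (PreSobolev 𝕜 k p I) :=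
  AddGroupSeminorm.toSeminormedAddCommGroup
    { toFun := fun f => f.quasiNorm ^ p
      map_zero' := by
        rw [quasiNorm_rpow hp.out.1]
        refine Finset.sum_eq_zero fun i _ => ?_
        have h0 : (0 : PreSobolev 𝕜 k p I).toFun = 0 := rfl
        have : iteratedDeriv i (0 : PreSobolev 𝕜 k p I).toFun = 0 := by
          have h1 : iteratedDeriv i (0 : ℝ → 𝕜) = (0 : 𝕜) • iteratedDeriv i (0 : ℝ → 𝕜) := by
            ext x
            simp
          rw [h0, h1, zero_smul]
        rw [this, eLpNorm_zero, ENNReal.toReal_zero, Real.zero_rpow hp.out.1.ne']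
      add_le' := fun f g => by
        rw [quasiNorm_rpow hp.out.1, quasiNorm_rpow hp.out.1, quasiNorm_rpow hp.out.1,
          ← Finset.sum_add_distrib]
        refine Finset.sum_le_sum fun i _ => ?_
        have h : iteratedDeriv i (f + g).toFun =
            iteratedDeriv i f.toFun + iteratedDeriv i g.toFun := by
          ext x
          exact iteratedDeriv_add (f.contDiff.contDiffAt.of_le (by exact_mod_cast le_top))
            (g.contDiff.contDiffAt.of_le (by exact_mod_cast le_top))
        rw [h]
        exact toReal_eLpNorm_rpow_add_le hp.out (f.memLp_iteratedDeriv i _)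
          (g.memLp_iteratedDeriv i _)
      neg' := fun f => by
        rw [quasiNorm_rpow hp.out.1, quasiNorm_rpow hp.out.1]
        refine Finset.sum_congr rfl fun i _ => ?_
        have h : iteratedDeriv i (-f).toFun = -iteratedDeriv i f.toFun := by
          ext x
          exact iteratedDeriv_neg i f.toFun x
        rw [h, eLpNorm_neg] }

theorem norm_def [Fact (p ∈ Set.Ioo (0 : ℝ) 1)] (f : PreSobolev 𝕜 k p I) :
    ‖f‖ = f.quasiNorm ^ p := rfl

theorem norm_smul_eq [hp : Fact (p ∈ Set.Ioo (0 : ℝ) 1)] (c : 𝕜) (f : PreSobolev 𝕜 k p I) :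
    ‖c • f‖ = ‖c‖ ^ p * ‖f‖ := by
  rw [norm_def, norm_def, quasiNorm_rpow hp.out.1, quasiNorm_rpow hp.out.1, Finset.mul_sum]
  refine Finset.sum_congr rfl fun i _ => ?_
  have h : iteratedDeriv i (c • f).toFun = c • iteratedDeriv i f.toFun := by
    ext x
    exact iteratedDeriv_const_smul_field c f.toFun
  rw [h, eLpNorm_const_smul, ENNReal.toReal_mul, toReal_enorm,
    Real.mul_rpow (norm_nonneg _) ENNReal.toReal_nonneg]

/-- Multiplication by a scalar is uniformly continuous, so it passes to the completion. -/
instance [hp : Fact (p ∈ Set.Ioo (0 : ℝ) 1)] :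
    UniformContinuousConstSMul 𝕜 (PreSobolev 𝕜 k p I) where
  uniformContinuous_const_smul c :=
    (AddMonoidHomClass.lipschitz_of_bound
      (DistribSMul.toAddMonoidHom (PreSobolev 𝕜 k p I) c) (‖c‖ ^ p)
      fun f => (norm_smul_eq c f).le).uniformContinuous

/-- The class in `L^p(I)` of the restriction of a test function to `I`. -/
def restrict (f : PreSobolev 𝕜 k p I) : LpSpace 𝕜 p I :=
  MemLp.toLp f.toFun (f.memLp (ENNReal.ofReal p))

/-- Differentiation of test functions, from the `W^{k+1,p}` to the `W^{k,p}` quasi-norm. -/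
def derivative (f : PreSobolev 𝕜 (k + 1) p I) : PreSobolev 𝕜 k p I :=
  Subtype.mk (p := (· ∈ testFunctions 𝕜)) (deriv f.toFun) f.deriv_mem

end PreSobolev

/-! ### The Sobolev space and its canonical maps -/

/-- `W^{k,p}(I)`: the abstract (Hausdorff) completion of `C_0^∞(ℝ)` restricted to `I` in the
Sobolev quasi-norm. -/
abbrev SobolevSpace (𝕜 : Type*) [RCLike 𝕜] (k : ℕ) (p : ℝ) (I : Set ℝ)
    [Fact (p ∈ Set.Ioo (0 : ℝ) 1)] : Type _ :=
  UniformSpace.Completion (PreSobolev 𝕜 k p I)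

variable {𝕜 : Type*} [RCLike 𝕜] {k : ℕ} {p : ℝ} {I : Set ℝ} [Fact (p ∈ Set.Ioo (0 : ℝ) 1)]

/-- The sequence `f` of test functions represents the element `x` of `W^{k,p}(I)`: `f` is a Cauchy
sequence for the Sobolev quasi-norm, and `x` is the point of the completion that it defines. -/
def Represents (f : ℕ → PreSobolev 𝕜 k p I) (x : SobolevSpace 𝕜 k p I) : Prop :=
  Tendsto (fun j => (f j : SobolevSpace 𝕜 k p I)) atTop (𝓝 x)

/-- `α : W^{k,p}(I) → L^p(I)`, the extension by continuity of `f ↦ f|_I`. -/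
def alpha : SobolevSpace 𝕜 k p I → LpSpace 𝕜 p I :=
  UniformSpace.Completion.extension PreSobolev.restrict

/-- `δ : W^{k+1,p}(I) → W^{k,p}(I)`, the extension by continuity of `f ↦ f'`. -/
def delta : SobolevSpace 𝕜 (k + 1) p I → SobolevSpace 𝕜 k p I :=
  UniformSpace.Completion.map PreSobolev.derivative

end PeetreSobolev

end

namespace PeetreSobolev

/-! ### Elements of `L^p(I)` and their representatives -/

/-! With `p`-th powers of quasi-norms as norms, a test function `f` in the `k + 1` quasi-norm
satisfies `‖f‖ = ‖f|_I‖ + ‖f'‖`. By continuity `‖x‖ = ‖α x‖ + ‖δ x‖` on the completion, so `(α, δ)`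
is linear, bi-Lipschitz and has closed range. Only the density of its range is at stake: the pairs
`(f|_I, f')` must be dense in the product.

This is Peetre's phenomenon. For `p < 1`, a climb from `0` to `1` over a length `a` has slope about
`1 / a` and costs only `a * a ^ (-p) = a ^ (1 - p)`, which tends to `0`. Repeated averaging gives
smooth steps on an arbitrarily short interval whose derivatives up to any fixed order are small in
`L^p` (`exists_smooth_step`). There are two consequences. Step functions are limits of test
functions with negligible derivatives, so all `(g, 0)` lie in the closure of the pairs
(`exists_approx_indicator`, `eq_top_of_indicator_Ico_mem`). Every test function is nearly a
derivative `f'`, because the constant left over by its primitive can be brought down to `0` at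
negligible cost (`exists_approx_derivative`). Adding `(g - f|_I, 0)` to `(f|_I, f')` then gives
density (`denseRange_restrictDerivative`).

Iterating down to `W^{0,p} ≅ L^p(I)` gives the power of `L^p(I)`. It collapses to `L^p(I)` because
`L^p(I)` is isomorphic to its square: a nondegenerate interval is, up to endpoints, diffeomorphic to
`ℝ`, a weighted composition identifies the two `L^p` spaces, and `ℝ` without `0` is two half-lines
(`nonempty_equiv_prod`). -/

theorem eLpNorm_ofReal_rpow {α E : Type*} [MeasurableSpace α] [NormedAddCommGroup E]
    {μ : Measure α} {p : ℝ} (hp : 0 < p) (h : α → E) :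
    eLpNorm h (ENNReal.ofReal p) μ ^ p = ∫⁻ x, ‖h x‖ₑ ^ p ∂μ := by
  rw [eLpNorm_eq_lintegral_rpow_enorm_toReal (by simpa using hp) ENNReal.ofReal_ne_top,
    ENNReal.toReal_ofReal hp.le, ← ENNReal.rpow_mul, one_div, inv_mul_cancel₀ hp.ne',
    ENNReal.rpow_one]

theorem memLp_ofReal_iff {α E : Type*} [MeasurableSpace α] [NormedAddCommGroup E]
    {μ : Measure α} {p : ℝ} (hp : 0 < p) {h : α → E} :
    MemLp h (ENNReal.ofReal p) μ ↔
      AEStronglyMeasurable h μ ∧ ∫⁻ x, ‖h x‖ₑ ^ p ∂μ < (⊤ : ℝ≥0∞) := by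
  rw [← eLpNorm_ofReal_rpow hp, ENNReal.rpow_lt_top_iff_of_pos hp]
  rfl

namespace LpSpace

variable {𝕜 : Type*} [RCLike 𝕜] {p : ℝ} {I : Set ℝ}

/-- A representative of a class in `L^p(I)`. -/
noncomputable def fn (f : LpSpace 𝕜 p I) : ℝ → 𝕜 :=
  (show Lp 𝕜 (ENNReal.ofReal p) (volume.restrict I) from f : ℝ →ₘ[volume.restrict I] 𝕜)

/-- The class in `L^p(I)` of a function. -/
noncomputable def ofFun (g : ℝ → 𝕜) (hg : MemLp g (ENNReal.ofReal p) (volume.restrict I)) :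
    LpSpace 𝕜 p I :=
  hg.toLp g

theorem memLp_fn (f : LpSpace 𝕜 p I) : MemLp f.fn (ENNReal.ofReal p) (volume.restrict I) :=
  Lp.memLp (show Lp 𝕜 (ENNReal.ofReal p) (volume.restrict I) from f)

theorem stronglyMeasurable_fn (f : LpSpace 𝕜 p I) : StronglyMeasurable f.fn :=
  Lp.stronglyMeasurable (show Lp 𝕜 (ENNReal.ofReal p) (volume.restrict I) from f)

theorem fn_ofFun {g : ℝ → 𝕜} (hg : MemLp g (ENNReal.ofReal p) (volume.restrict I)) :
    (ofFun g hg).fn =ᵐ[volume.restrict I] g :=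
  hg.coeFn_toLp

theorem ofFun_fn (f : LpSpace 𝕜 p I) : ofFun f.fn f.memLp_fn = f :=
  Lp.toLp_coeFn (show Lp 𝕜 (ENNReal.ofReal p) (volume.restrict I) from f) _

theorem ofFun_congr {g h : ℝ → 𝕜} (hg : MemLp g (ENNReal.ofReal p) (volume.restrict I))
    (hh : MemLp h (ENNReal.ofReal p) (volume.restrict I)) (e : g =ᵐ[volume.restrict I] h) :
    ofFun g hg = ofFun h hh :=
  (MemLp.toLp_eq_toLp_iff hg hh).2 e

theorem ext_fn {f g : LpSpace 𝕜 p I} (e : f.fn =ᵐ[volume.restrict I] g.fn) : f = g := by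
  rw [← ofFun_fn f, ← ofFun_fn g]
  exact ofFun_congr _ _ e

theorem ofFun_add {g h : ℝ → 𝕜} (hg : MemLp g (ENNReal.ofReal p) (volume.restrict I))
    (hh : MemLp h (ENNReal.ofReal p) (volume.restrict I)) :
    ofFun (g + h) (hg.add hh) = ofFun g hg + ofFun h hh :=
  rfl

theorem ofFun_sub {g h : ℝ → 𝕜} (hg : MemLp g (ENNReal.ofReal p) (volume.restrict I))
    (hh : MemLp h (ENNReal.ofReal p) (volume.restrict I)) :
    ofFun (g - h) (hg.sub hh) = ofFun g hg - ofFun h hh :=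
  rfl

theorem ofFun_const_smul {g : ℝ → 𝕜} (hg : MemLp g (ENNReal.ofReal p) (volume.restrict I))
    (c : 𝕜) : ofFun (c • g) (hg.const_smul c) = c • ofFun g hg :=
  rfl

theorem fn_add (f g : LpSpace 𝕜 p I) : (f + g).fn =ᵐ[volume.restrict I] f.fn + g.fn :=
  Lp.coeFn_add (show Lp 𝕜 (ENNReal.ofReal p) (volume.restrict I) from f) g

theorem fn_const_smul (c : 𝕜) (f : LpSpace 𝕜 p I) :
    (c • f).fn =ᵐ[volume.restrict I] c • f.fn :=
  Lp.coeFn_smul c (show Lp 𝕜 (ENNReal.ofReal p) (volume.restrict I) from f)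

variable [hp : Fact (p ∈ Set.Ioo (0 : ℝ) 1)]

/-- The norm is already the `p`-th power of the quasi-norm, so no root appears. Later estimates are
made on these extended-valued integrals. -/
theorem enorm_ofFun {g : ℝ → 𝕜} (hg : MemLp g (ENNReal.ofReal p) (volume.restrict I)) :
    ‖ofFun g hg‖ₑ = ∫⁻ x in I, ‖g x‖ₑ ^ p := by
  have h : ‖ofFun g hg‖ = (eLpNorm g (ENNReal.ofReal p) (volume.restrict I)).toReal ^ p := by
    rw [← eLpNorm_congr_ae hg.coeFn_toLp]
    rfl
  rw [← ofReal_norm, h, ENNReal.toReal_rpow, eLpNorm_ofReal_rpow hp.out.1,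
    ENNReal.ofReal_toReal]
  exact ((memLp_ofReal_iff hp.out.1).1 hg).2.ne

theorem enorm_eq_lintegral (f : LpSpace 𝕜 p I) : ‖f‖ₑ = ∫⁻ x in I, ‖f.fn x‖ₑ ^ p := by
  conv_lhs => rw [← ofFun_fn f]
  exact enorm_ofFun _

end LpSpace

/-! ### Completeness of `L^p(I)` -/

/-- Subadditivity of `t ↦ t ^ p` passes to the limit of partial sums. In the completeness proof it
takes the place of Minkowski's inequality. -/
theorem rpow_tsum_le_tsum_rpow {p : ℝ} (h0 : 0 < p) (h1 : p ≤ 1) (a : ℕ → ℝ≥0∞) :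
    (∑' i, a i) ^ p ≤ ∑' i, a i ^ p := by
  have ht : Tendsto (fun n => (∑ i ∈ Finset.range n, a i) ^ p) atTop (𝓝 ((∑' i, a i) ^ p)) :=
    ((ENNReal.continuous_rpow_const).tendsto _).comp (ENNReal.tendsto_nat_tsum a)
  refine le_of_tendsto' ht fun n => ?_
  calc (∑ i ∈ Finset.range n, a i) ^ p ≤ ∑ i ∈ Finset.range n, a i ^ p :=
        Finset.le_sum_of_subadditive (fun x : ℝ≥0∞ => x ^ p) (ENNReal.zero_rpow_of_pos h0).le
          (fun x y => ENNReal.rpow_add_le_add_rpow x y h0.le h1) _ _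
    _ ≤ ∑' i, a i ^ p := ENNReal.sum_le_tsum _

/-- Riesz–Fischer: `∑ |u i| ^ p` is integrable and dominates `(∑ |u i|) ^ p`, so the series
converges almost everywhere. The same inequality applied to the tails gives convergence in `L^p(I)`.
Completeness is what makes the extension `alpha` continuous. -/
instance {𝕜 : Type*} [RCLike 𝕜] {p : ℝ} {I : Set ℝ} [hp : Fact (p ∈ Set.Ioo (0 : ℝ) 1)] :
    CompleteSpace (LpSpace 𝕜 p I) := by
  obtain ⟨h0, h1⟩ := hp.out
  refine NormedAddCommGroup.completeSpace_of_summable_imp_tendsto fun u hu => ?_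
  have hfin : ∑' i, ‖u i‖ₑ ≠ (⊤ : ℝ≥0∞) := by
    simp_rw [← ofReal_norm]
    exact hu.tsum_ofReal_ne_top
  have hmeas : ∀ i, Measurable fun x => ‖(u i).fn x‖ₑ ^ p := fun i =>
    (u i).stronglyMeasurable_fn.enorm.pow_const p
  have hint : ∀ n, ∫⁻ x in I, ∑' i, ‖(u (i + n)).fn x‖ₑ ^ p = ∑' i, ‖u (i + n)‖ₑ := fun n => by
    rw [lintegral_tsum fun i => (hmeas (i + n)).aemeasurable]
    simp_rw [LpSpace.enorm_eq_lintegral]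
  have hsum : ∀ᵐ x ∂(volume.restrict I), Summable fun i => (u i).fn x := by
    have hae := ae_lt_top (μ := volume.restrict I)
      (Measurable.tsum hmeas) (by simpa using (hint 0).trans_ne hfin)
    filter_upwards [hae] with x hx
    have h2 : (∑' i, ‖(u i).fn x‖ₑ) ^ p < (⊤ : ℝ≥0∞) := (rpow_tsum_le_tsum_rpow h0 h1.le _).trans_lt hx
    rw [ENNReal.rpow_lt_top_iff_of_pos h0] at h2
    refine Summable.of_norm ?_
    have := ENNReal.summable_toReal h2.ne
    simpa using this
  set s : ℝ → 𝕜 := fun x => ∑' i, (u i).fn x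
  have hS : ∀ n, MemLp (∑ i ∈ Finset.range n, (u i).fn) (ENNReal.ofReal p)
      (volume.restrict I) := fun n => memLp_finsetSum' _ fun i _ => (u i).memLp_fn
  have hs : AEStronglyMeasurable s (volume.restrict I) := by
    refine aestronglyMeasurable_of_tendsto_ae atTop (fun n => (hS n).1) ?_
    filter_upwards [hsum] with x hx
    simpa using hx.hasSum.tendsto_sum_nat
  have htail : ∀ n, ∫⁻ x in I, ‖(s - ∑ i ∈ Finset.range n, (u i).fn) x‖ₑ ^ p ≤
      ∑' i, ‖u (i + n)‖ₑ := fun n => by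
    rw [← hint n]
    refine lintegral_mono_ae ?_
    filter_upwards [hsum] with x hx
    have : (s - ∑ i ∈ Finset.range n, (u i).fn) x = ∑' i, (u (i + n)).fn x := by
      rw [Pi.sub_apply, Finset.sum_apply, sub_eq_iff_eq_add', hx.sum_add_tsum_nat_add n]
    rw [this]
    refine (ENNReal.rpow_le_rpow enorm_tsum_le_tsum_enorm h0.le).trans ?_
    exact rpow_tsum_le_tsum_rpow h0 h1.le _
  have hsm : MemLp s (ENNReal.ofReal p) (volume.restrict I) := by
    refine (memLp_ofReal_iff h0).2 ⟨hs, ?_⟩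
    have := (htail 0).trans_lt (by simpa using hfin.lt_top)
    simpa using this
  refine ⟨LpSpace.ofFun s hsm, ?_⟩
  have hpart : ∀ n, ∑ i ∈ Finset.range n, u i = LpSpace.ofFun _ (hS n) := fun n => by
    induction n with
    | zero => rfl
    | succ n ih =>
      rw [Finset.sum_range_succ, ih]
      conv_lhs => rw [← LpSpace.ofFun_fn (u n), ← LpSpace.ofFun_add]
      simp_rw [Finset.sum_range_succ]
  rw [tendsto_iff_edist_tendsto_0]
  refine tendsto_of_tendsto_of_tendsto_of_le_of_le tendsto_const_nhds
    (ENNReal.tendsto_sum_nat_add _ hfin) (fun _ => zero_le) fun n => ?_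
  rw [edist_comm, hpart, edist_eq_enorm_sub, ← LpSpace.ofFun_sub, LpSpace.enorm_ofFun]
  exact htail n

/-! ### Linear homeomorphisms from two-sided estimates -/

/-- A linear bijection with two-sided norm estimates is a linear homeomorphism. -/
noncomputable def continuousLinearEquivOfBounds {𝕜 E F : Type*} [Semiring 𝕜] [NormedAddCommGroup E]
    [NormedAddCommGroup F] [Module 𝕜 E] [Module 𝕜 F] (f : E →ₗ[𝕜] F) (C D : ℝ)
    (hC : ∀ x, ‖f x‖ ≤ C * ‖x‖) (hD : ∀ x, ‖x‖ ≤ D * ‖f x‖) (hf : Function.Surjective f) :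
    E ≃L[𝕜] F :=
  let e := LinearEquiv.ofBijective f ⟨by
    refine (injective_iff_map_eq_zero f).2 fun x hx => ?_
    simpa [hx] using hD x, hf⟩
  { e with
    continuous_toFun := AddMonoidHomClass.continuous_of_bound f C hC
    continuous_invFun := AddMonoidHomClass.continuous_of_bound e.symm D fun y => by
      have := hD (e.symm y)
      rwa [show f (e.symm y) = y from e.apply_symm_apply y] at this }

/-! ### Change of variables -/

/-- A differentiable injective map of the line with nonvanishing derivative. -/
structure IsChart (φ : ℝ → ℝ) : Prop where
  differentiable : Differentiable ℝ φ
  deriv_ne_zero : ∀ x, deriv φ x ≠ 0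
  injective : Function.Injective φ

namespace IsChart

variable {φ : ℝ → ℝ}

theorem measurableEmbedding (h : IsChart φ) : MeasurableEmbedding φ :=
  h.differentiable.continuous.measurableEmbedding h.injective

theorem setLIntegral_range (h : IsChart φ) (g : ℝ → ℝ≥0∞) :
    ∫⁻ y in Set.range φ, g y = ∫⁻ x, ENNReal.ofReal |deriv φ x| * g (φ x) := by
  rw [← Set.image_univ, lintegral_image_eq_lintegral_abs_deriv_mul MeasurableSet.univ
    (fun x _ => (h.differentiable x).hasDerivAt.hasDerivWithinAt) h.injective.injOn,
    Measure.restrict_univ]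

/-- For a null set `s`, the change of variables gives `∫ |φ'| * 1_s(φ x) = 0`, and `φ'` never
vanishes. Composition with `φ` therefore respects almost everywhere equality. -/
theorem quasiMeasurePreserving (h : IsChart φ) :
    Measure.QuasiMeasurePreserving φ volume (volume.restrict (Set.range φ)) := by
  refine ⟨h.measurableEmbedding.measurable, Measure.AbsolutelyContinuous.mk fun s hs h0 => ?_⟩
  have h1 := h.setLIntegral_range (s.indicator 1)
  rw [lintegral_indicator_one hs, h0] at h1
  have h2 := (lintegral_eq_zero_iff (by
    refine Measurable.mul (by fun_prop) ?_
    exact (measurable_one.indicator hs).comp h.measurableEmbedding.measurable)).1 h1.symm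
  rw [Measure.map_apply h.measurableEmbedding.measurable hs, measure_eq_zero_iff_ae_notMem]
  filter_upwards [h2] with x hx hxs
  have : s.indicator (1 : ℝ → ℝ≥0∞) (φ x) = 1 :=
    Set.indicator_of_mem (show φ x ∈ s from hxs) _
  simp [this, h.deriv_ne_zero x] at hx

variable {𝕜 : Type*} [RCLike 𝕜]

/-- The exponent `p⁻¹` is chosen so that the `p`-th power of the weight is the Jacobian of `φ`. -/
theorem enorm_weight_smul_rpow {p : ℝ} (hp : 0 < p) (x : ℝ) (z : 𝕜) :
    ‖(|deriv φ x| ^ p⁻¹) • z‖ₑ ^ p = ENNReal.ofReal |deriv φ x| * ‖z‖ₑ ^ p := by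
  rw [enorm_smul, ENNReal.mul_rpow_of_nonneg _ _ hp.le, Real.enorm_of_nonneg (by positivity),
    ENNReal.ofReal_rpow_of_nonneg (by positivity) hp.le, ← Real.rpow_mul (by positivity),
    inv_mul_cancel₀ hp.ne', Real.rpow_one]

theorem lintegral_weight_smul_comp (h : IsChart φ) {p : ℝ} (hp : 0 < p) (g : ℝ → 𝕜) :
    ∫⁻ x, ‖(|deriv φ x| ^ p⁻¹) • g (φ x)‖ₑ ^ p = ∫⁻ y in Set.range φ, ‖g y‖ₑ ^ p := by
  simp_rw [enorm_weight_smul_rpow hp]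
  exact (h.setLIntegral_range fun y => ‖g y‖ₑ ^ p).symm

end IsChart

/-! ### Weighted composition operators and the splitting of `L^p(I)` along charts. -/

namespace LpSpace

variable {𝕜 : Type*} [RCLike 𝕜] {p : ℝ} {I : Set ℝ} {φ : ℝ → ℝ}

theorem ae_comp_eq {β : Type*} (h : IsChart φ)
    (hI : volume.restrict (Set.range φ) ≤ volume.restrict I) {g g' : ℝ → β}
    (e : g =ᵐ[volume.restrict I] g') : ∀ᵐ x, g (φ x) = g' (φ x) :=
  h.quasiMeasurePreserving.ae (ae_mono hI e)

theorem memLp_pullback (hp : 0 < p) (h : IsChart φ)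
    (hI : volume.restrict (Set.range φ) ≤ volume.restrict I) {g : ℝ → 𝕜}
    (hg : MemLp g (ENNReal.ofReal p) (volume.restrict I)) :
    MemLp (fun x => (|deriv φ x| ^ p⁻¹) • g (φ x)) (ENNReal.ofReal p)
      (volume.restrict Set.univ) := by
  have hg' := hg.mono_measure hI
  rw [Measure.restrict_univ, memLp_ofReal_iff hp, h.lintegral_weight_smul_comp hp]
  refine ⟨?_, ((memLp_ofReal_iff hp).1 hg').2⟩
  exact AEStronglyMeasurable.smul
    (((measurable_deriv φ).abs.pow_const _).aestronglyMeasurable)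
    (hg'.1.comp_quasiMeasurePreserving h.quasiMeasurePreserving)

variable [hp : Fact (p ∈ Set.Ioo (0 : ℝ) 1)]

/-- The weighted composition `g ↦ |φ'| ^ (1 / p) • (g ∘ φ)` from `L^p(I)` to `L^p(ℝ)`. -/
noncomputable def pullback (h : IsChart φ)
    (hI : volume.restrict (Set.range φ) ≤ volume.restrict I) :
    LpSpace 𝕜 p I →ₗ[𝕜] LpSpace 𝕜 p Set.univ where
  toFun g := ofFun _ (memLp_pullback hp.out.1 h hI g.memLp_fn)
  map_add' f g := by
    rw [← ofFun_add]
    refine ofFun_congr _ _ ?_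
    rw [Measure.restrict_univ]
    filter_upwards [ae_comp_eq h hI (fn_add f g)] with x hx
    simp [hx]
  map_smul' c f := by
    rw [RingHom.id_apply, ← ofFun_const_smul]
    refine ofFun_congr _ _ ?_
    rw [Measure.restrict_univ]
    filter_upwards [ae_comp_eq h hI (fn_const_smul c f)] with x hx
    simp [hx]

theorem enorm_pullback (h : IsChart φ)
    (hI : volume.restrict (Set.range φ) ≤ volume.restrict I) (g : LpSpace 𝕜 p I) :
    ‖pullback h hI g‖ₑ = ∫⁻ y in Set.range φ, ‖g.fn y‖ₑ ^ p := by
  rw [← h.lintegral_weight_smul_comp hp.out.1 g.fn]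
  refine (enorm_ofFun (memLp_pullback hp.out.1 h hI g.memLp_fn)).trans ?_
  rw [Measure.restrict_univ]

variable {ι : Type*} {Φ : ι → ℝ → ℝ}

theorem restrict_range_le (hI : I =ᵐ[volume] ⋃ i, Set.range (Φ i)) (i : ι) :
    volume.restrict (Set.range (Φ i)) ≤ volume.restrict I := by
  rw [Measure.restrict_congr_set hI]
  exact Measure.restrict_mono (Set.subset_iUnion (fun i => Set.range (Φ i)) i) le_rfl

variable [Fintype ι]

theorem setLIntegral_eq_sum_range (h : ∀ i, IsChart (Φ i))
    (hd : Pairwise (Function.onFun Disjoint fun i => Set.range (Φ i)))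
    (hI : I =ᵐ[volume] ⋃ i, Set.range (Φ i)) (G : ℝ → ℝ≥0∞) :
    ∫⁻ y in I, G y = ∑ i, ∫⁻ y in Set.range (Φ i), G y := by
  rw [Measure.restrict_congr_set hI,
    lintegral_iUnion (fun i => (h i).measurableEmbedding.measurableSet_range) hd, tsum_fintype]

theorem enorm_eq_sum_pullback (h : ∀ i, IsChart (Φ i))
    (hd : Pairwise (Function.onFun Disjoint fun i => Set.range (Φ i)))
    (hI : I =ᵐ[volume] ⋃ i, Set.range (Φ i)) (g : LpSpace 𝕜 p I) :
    ‖g‖ₑ = ∑ i, ‖pullback (h i) (restrict_range_le hI i) g‖ₑ := by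
  simp_rw [enorm_pullback, enorm_eq_lintegral]
  exact setLIntegral_eq_sum_range h hd hI _

theorem norm_eq_sum_pullback (h : ∀ i, IsChart (Φ i))
    (hd : Pairwise (Function.onFun Disjoint fun i => Set.range (Φ i)))
    (hI : I =ᵐ[volume] ⋃ i, Set.range (Φ i)) (g : LpSpace 𝕜 p I) :
    ‖g‖ = ∑ i, ‖pullback (h i) (restrict_range_le hI i) g‖ := by
  have := congrArg ENNReal.toReal (enorm_eq_sum_pullback h hd hI g)
  rwa [ENNReal.toReal_sum fun i _ => enorm_ne_top, toReal_enorm] at this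

/-- On each range the weight is undone and the result extended by zero. The ranges are disjoint, so
only one term of the sum over charts is nonzero at a given point. -/
theorem exists_pullback_eq (h : ∀ i, IsChart (Φ i))
    (hd : Pairwise (Function.onFun Disjoint fun i => Set.range (Φ i)))
    (hI : I =ᵐ[volume] ⋃ i, Set.range (Φ i)) (f : ι → LpSpace 𝕜 p Set.univ) :
    ∃ g : LpSpace 𝕜 p I, ∀ i, pullback (h i) (restrict_range_le hI i) g = f i := by
  classical
  obtain ⟨h0, h1⟩ := hp.out
  set H : ι → ℝ → 𝕜 := fun i x => (|deriv (Φ i) x| ^ p⁻¹)⁻¹ • (f i).fn x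
  set g : ℝ → 𝕜 := fun y => ∑ i, Function.extend (Φ i) (H i) 0 y
  have hg : Measurable g := Finset.measurable_sum _ fun i _ =>
    (h i).measurableEmbedding.measurable_extend
      ((((measurable_deriv _).abs.pow_const _).inv).smul (f i).stronglyMeasurable_fn.measurable)
      measurable_zero
  have hgΦ : ∀ i x, g (Φ i x) = H i x := fun i x => by
    refine (Finset.sum_eq_single i (fun j _ hj => ?_) (by simp)).trans
      ((h i).injective.extend_apply _ _ _)
    refine Function.extend_apply' _ _ _ fun ⟨z, hz⟩ => ?_
    exact Set.disjoint_left.1 (hd hj) ⟨z, hz⟩ ⟨x, rfl⟩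
  have hval : ∀ i x, (|deriv (Φ i) x| ^ p⁻¹) • g (Φ i x) = (f i).fn x := fun i x => by
    rw [hgΦ, smul_inv_smul₀]
    exact (Real.rpow_pos_of_pos (abs_pos.2 ((h i).deriv_ne_zero x)) _).ne'
  have hmem : MemLp g (ENNReal.ofReal p) (volume.restrict I) := by
    refine (memLp_ofReal_iff h0).2 ⟨hg.aestronglyMeasurable, ?_⟩
    rw [setLIntegral_eq_sum_range h hd hI]
    refine ENNReal.sum_lt_top.2 fun i _ => ?_
    rw [← (h i).lintegral_weight_smul_comp h0]
    simp_rw [hval]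
    have := ((memLp_ofReal_iff h0).1 (f i).memLp_fn).2
    rwa [Measure.restrict_univ] at this
  refine ⟨ofFun g hmem, fun i => ?_⟩
  rw [← ofFun_fn (f i)]
  refine ofFun_congr (memLp_pullback h0 (h i) (restrict_range_le hI i) (ofFun g hmem).memLp_fn)
    _ ?_
  rw [Measure.restrict_univ]
  filter_upwards [ae_comp_eq (h i) (restrict_range_le hI i) (fn_ofFun hmem)] with x hx
  rw [hx, hval]

/-- If `I` is, up to a null set, the disjoint union of the ranges of finitely many charts, then
`L^p(I)` is a finite power of `L^p(ℝ)`. -/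
theorem nonempty_equiv_pi (h : ∀ i, IsChart (Φ i))
    (hd : Pairwise (Function.onFun Disjoint fun i => Set.range (Φ i)))
    (hI : I =ᵐ[volume] ⋃ i, Set.range (Φ i)) :
    Nonempty (LpSpace 𝕜 p I ≃L[𝕜] (ι → LpSpace 𝕜 p Set.univ)) := by
  -- `‖g‖` is the sum of the norms of the components while the product carries their maximum, whence
  -- the constants `1` and the number of charts.
  refine ⟨continuousLinearEquivOfBounds
    (LinearMap.pi fun i => pullback (h i) (restrict_range_le hI i)) 1 (Fintype.card ι)
    (fun g => ?_) (fun g => ?_) fun f => ?_⟩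
  · rw [one_mul]
    refine (pi_norm_le_iff_of_nonneg (norm_nonneg _)).2 fun i => ?_
    rw [norm_eq_sum_pullback h hd hI g]
    exact Finset.single_le_sum
      (f := fun i => ‖pullback (h i) (restrict_range_le hI i) g‖)
      (fun i _ => norm_nonneg _) (Finset.mem_univ i)
  · rw [norm_eq_sum_pullback h hd hI g, ← nsmul_eq_mul]
    exact Pi.sum_norm_apply_le_norm
      (LinearMap.pi (fun i => pullback (h i) (restrict_range_le hI i)) g)
  · obtain ⟨g, hg⟩ := exists_pullback_eq h hd hI f
    exact ⟨g, funext hg⟩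

/-! ### All spaces `L^p(I)` over intervals are isomorphic to their square -/

theorem isChart_const_add_mul_exp (a : ℝ) {c : ℝ} (hc : c ≠ 0) :
    IsChart fun x => a + c * Real.exp x where
  differentiable := by fun_prop
  deriv_ne_zero x := by
    have : HasDerivAt (fun x => a + c * Real.exp x) (c * Real.exp x) x :=
      ((Real.hasDerivAt_exp x).const_mul c).const_add a
    rw [this.deriv]
    exact mul_ne_zero hc (Real.exp_pos x).ne'
  injective x y hxy := by simpa [hc] using hxy

theorem isChart_const_add_mul_sigmoid (a : ℝ) {c : ℝ} (hc : c ≠ 0) :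
    IsChart fun x => a + c * Real.sigmoid x where
  differentiable x :=
    (((Real.hasDerivAt_sigmoid x).const_mul c).const_add a).differentiableAt
  deriv_ne_zero x := by
    rw [(((Real.hasDerivAt_sigmoid x).const_mul c).const_add a).deriv]
    exact mul_ne_zero hc (mul_pos (Real.sigmoid_pos x)
      (sub_pos.2 (Real.sigmoid_lt_one x))).ne'
  injective x y hxy := by simpa [hc] using hxy

theorem isChart_id : IsChart fun x => x where
  differentiable := differentiable_fun_id
  deriv_ne_zero x := by simp
  injective := Function.injective_id

theorem range_const_add_exp (a : ℝ) : Set.range (fun x => a + 1 * Real.exp x) = Set.Ioi a := by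
  ext y
  refine ⟨?_, fun hy => ⟨Real.log (y - a), ?_⟩⟩
  · rintro ⟨x, rfl⟩
    simpa using Real.exp_pos x
  · have : 0 < y - a := sub_pos.2 hy
    simp [Real.exp_log this]

theorem range_const_sub_exp (a : ℝ) :
    Set.range (fun x => a + (-1) * Real.exp x) = Set.Iio a := by
  ext y
  refine ⟨?_, fun hy => ⟨Real.log (a - y), ?_⟩⟩
  · rintro ⟨x, rfl⟩
    simpa using Real.exp_pos x
  · have : 0 < a - y := sub_pos.2 hy
    simp [Real.exp_log this]

theorem range_const_add_mul_sigmoid {a b : ℝ} (hab : a < b) :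
    Set.range (fun x => a + (b - a) * Real.sigmoid x) = Set.Ioo a b := by
  have hba := sub_pos.2 hab
  have : (fun x => a + (b - a) * Real.sigmoid x) =
      (fun t => a + (b - a) * t) ∘ Real.sigmoid := rfl
  rw [this, Set.range_comp, Real.range_sigmoid]
  ext y
  refine ⟨?_, fun hy => ⟨(y - a) / (b - a), ?_, by field_simp; ring⟩⟩
  · rintro ⟨t, ht, rfl⟩
    constructor <;> nlinarith [ht.1, ht.2]
  · exact ⟨div_pos (sub_pos.2 hy.1) hba, (div_lt_one hba).2 (by linarith [hy.2])⟩

/-- Endpoints are null, so only open intervals matter: an affine image of the sigmoid covers a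
bounded one, of the exponential a half-line, and the identity covers `ℝ`. Empty and one-point
intervals fall under the null alternative. -/
theorem exists_isChart_of_ordConnected (hI : I.OrdConnected) :
    volume I = 0 ∨ ∃ φ, IsChart φ ∧ I =ᵐ[volume] Set.range φ := by
  have hIoo : ∀ a b : ℝ, volume (Set.Ioo a b) = 0 ∨
      ∃ φ, IsChart φ ∧ Set.Ioo a b =ᵐ[volume] Set.range φ := fun a b => by
    rcases lt_or_ge a b with hab | hab
    · refine Or.inr ⟨_, isChart_const_add_mul_sigmoid a (sub_pos.2 hab).ne', ?_⟩
      exact EventuallyEq.of_eq (range_const_add_mul_sigmoid hab).symm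
    · exact Or.inl (by simp [Set.Ioo_eq_empty hab.not_gt])
  have hIoi : ∀ a : ℝ, ∃ φ, IsChart φ ∧ Set.Ioi a =ᵐ[volume] Set.range φ := fun a =>
    ⟨_, isChart_const_add_mul_exp a one_ne_zero, EventuallyEq.of_eq (range_const_add_exp a).symm⟩
  have hIio : ∀ a : ℝ, ∃ φ, IsChart φ ∧ Set.Iio a =ᵐ[volume] Set.range φ := fun a =>
    ⟨_, isChart_const_add_mul_exp a (neg_ne_zero.2 one_ne_zero),
      EventuallyEq.of_eq (range_const_sub_exp a).symm⟩
  have congr : ∀ {s t : Set ℝ}, s =ᵐ[volume] t →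
      (volume s = 0 ∨ ∃ φ, IsChart φ ∧ s =ᵐ[volume] Set.range φ) →
      (volume t = 0 ∨ ∃ φ, IsChart φ ∧ t =ᵐ[volume] Set.range φ) := by
    rintro s t e (h | ⟨φ, h, h'⟩)
    · exact Or.inl (by rwa [← measure_congr e])
    · exact Or.inr ⟨φ, h, e.symm.trans h'⟩
  have hcases := hI.isPreconnected.mem_intervals
  simp only [Set.mem_insert_iff, Set.mem_singleton_iff] at hcases
  rcases hcases with h | h | h | h | h | h | h | h | h | h <;> rw [h]
  · exact congr Ioo_ae_eq_Icc (hIoo _ _)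
  · exact congr Ioo_ae_eq_Ico (hIoo _ _)
  · exact congr Ioo_ae_eq_Ioc (hIoo _ _)
  · exact hIoo _ _
  · exact congr Ioi_ae_eq_Ici (Or.inr (hIoi _))
  · exact Or.inr (hIoi _)
  · exact congr Iio_ae_eq_Iic (Or.inr (hIio _))
  · exact Or.inr (hIio _)
  · exact Or.inr ⟨_, isChart_id, EventuallyEq.of_eq Set.range_id'.symm⟩
  · exact Or.inl measure_empty

/-- Away from the null set `{0}` the line is two half-lines, each the range of an exponential chart.
-/
theorem nonempty_equiv_prod_univ :
    Nonempty (LpSpace 𝕜 p Set.univ ≃L[𝕜] LpSpace 𝕜 p Set.univ × LpSpace 𝕜 p Set.univ) := by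
  obtain ⟨e⟩ := nonempty_equiv_pi (𝕜 := 𝕜) (p := p) (I := Set.univ)
    (Φ := ![fun x => 0 + 1 * Real.exp x, fun x => 0 + (-1) * Real.exp x])
    (by
      intro i
      fin_cases i
      · exact isChart_const_add_mul_exp 0 one_ne_zero
      · exact isChart_const_add_mul_exp 0 (neg_ne_zero.2 one_ne_zero))
    (by
      have hdis : Disjoint (Set.Ioi (0 : ℝ)) (Set.Iio 0) :=
        Set.disjoint_left.2 fun x hx hx' => lt_asymm (Set.mem_Ioi.1 hx) (Set.mem_Iio.1 hx')
      rw [← range_const_add_exp, ← range_const_sub_exp] at hdis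
      intro i j hij
      fin_cases i <;> fin_cases j
      · exact absurd rfl hij
      · exact hdis
      · exact hdis.symm
      · exact absurd rfl hij)
    (by
      refine Filter.EventuallyEq.symm (eventuallyEq_univ.2 ?_)
      rw [mem_ae_iff]
      refine measure_mono_null (t := {0}) (fun x hx => ?_) (measure_singleton 0)
      by_contra hne
      refine hx (Set.mem_iUnion.2 ?_)
      rcases lt_or_gt_of_ne (show x ≠ 0 from hne) with h | h
      · exact ⟨1, by
          show x ∈ Set.range fun x => 0 + (-1) * Real.exp x
          rw [range_const_sub_exp]; exact h⟩
      · exact ⟨0, by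
          show x ∈ Set.range fun x => 0 + 1 * Real.exp x
          rw [range_const_add_exp]; exact h⟩)
  exact ⟨e.trans (ContinuousLinearEquiv.piFinTwo 𝕜 fun _ => LpSpace 𝕜 p Set.univ)⟩

/-- The splitting of `L^p(ℝ)` is transported along a chart of `I`; for null `I` the space is zero.
-/
theorem nonempty_equiv_prod (hI : I.OrdConnected) :
    Nonempty (LpSpace 𝕜 p I ≃L[𝕜] LpSpace 𝕜 p I × LpSpace 𝕜 p I) := by
  rcases exists_isChart_of_ordConnected hI with h | ⟨φ, hφ, e⟩
  · have hsub : Subsingleton (LpSpace 𝕜 p I) := ⟨fun f g => ext_fn (by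
      rw [Measure.restrict_eq_zero.2 h]
      exact ae_zero.le trivial)⟩
    exact ⟨continuousLinearEquivOfBounds 0 0 0 (fun x => by simp)
      (fun x => by simp [Subsingleton.elim x 0]) fun y => ⟨0, Subsingleton.elim _ _⟩⟩
  · obtain ⟨e₁⟩ := nonempty_equiv_pi (𝕜 := 𝕜) (p := p) (I := I) (ι := Unit) (fun _ => hφ)
      (fun i j hij => absurd rfl hij) (by rwa [Set.iUnion_const])
    obtain ⟨e₂⟩ := nonempty_equiv_prod_univ (𝕜 := 𝕜) (p := p)
    let e₃ := e₁.trans (ContinuousLinearEquiv.funUnique Unit 𝕜 (LpSpace 𝕜 p Set.univ))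
    exact ⟨(e₃.trans e₂).trans (e₃.symm.prodCongr e₃.symm)⟩

theorem nonempty_pi_equiv (hI : I.OrdConnected) (n : ℕ) :
    Nonempty ((Fin (n + 1) → LpSpace 𝕜 p I) ≃L[𝕜] LpSpace 𝕜 p I) := by
  induction n with
  | zero => exact ⟨ContinuousLinearEquiv.funUnique (Fin 1) 𝕜 _⟩
  | succ n ih =>
    obtain ⟨e⟩ := ih
    obtain ⟨e₂⟩ := nonempty_equiv_prod (𝕜 := 𝕜) (p := p) hI
    exact ⟨((Fin.consEquivL 𝕜 fun _ : Fin (n + 2) => LpSpace 𝕜 p I).symm.trans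
      ((ContinuousLinearEquiv.refl 𝕜 _).prodCongr e)).trans e₂.symm⟩

end LpSpace

/-! ### Density of step functions in `L^p(I)` -/

namespace LpSpace

variable {𝕜 : Type*} [RCLike 𝕜] {p : ℝ} {I : Set ℝ}

/-- The class of the function equal to `c` on `s` and to `0` elsewhere lies in `S`. -/
def IndicatorMem (S : AddSubgroup (LpSpace 𝕜 p I)) (c : 𝕜) (s : Set ℝ) : Prop :=
  ∃ h : MemLp (s.indicator fun _ => c) (ENNReal.ofReal p) (volume.restrict I), ofFun _ h ∈ S

variable {S : AddSubgroup (LpSpace 𝕜 p I)} {c : 𝕜} {s t : Set ℝ}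

theorem IndicatorMem.diff (hs : IndicatorMem S c s) (ht : IndicatorMem S c t) (hts : t ⊆ s) :
    IndicatorMem S c (s \ t) := by
  obtain ⟨hs, hsS⟩ := hs
  obtain ⟨ht, htS⟩ := ht
  have e : (s \ t).indicator (fun _ => c) = s.indicator (fun _ => c) - t.indicator fun _ => c :=
    Set.indicator_sdiff hts _
  rw [IndicatorMem, e]
  exact ⟨hs.sub ht, by rw [ofFun_sub hs ht]; exact S.sub_mem hsS htS⟩

theorem IndicatorMem.union (hs : IndicatorMem S c s) (ht : IndicatorMem S c t)
    (hst : Disjoint s t) : IndicatorMem S c (s ∪ t) := by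
  obtain ⟨hs, hsS⟩ := hs
  obtain ⟨ht, htS⟩ := ht
  have e : (s ∪ t).indicator (fun _ => c) = s.indicator (fun _ => c) + t.indicator fun _ => c :=
    Set.indicator_union_of_disjoint hst _
  rw [IndicatorMem, e]
  exact ⟨hs.add ht, by rw [ofFun_add hs ht]; exact S.add_mem hsS htS⟩

theorem IndicatorMem.empty : IndicatorMem S c ∅ := by
  rw [IndicatorMem, Set.indicator_empty]
  exact ⟨MemLp.zero, S.zero_mem⟩

theorem lintegral_indicator_const_rpow (hp : 0 < p) (μ : Measure ℝ) (hs : MeasurableSet s)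
    (c : 𝕜) : ∫⁻ x, ‖s.indicator (fun _ => c) x‖ₑ ^ p ∂μ = ‖c‖ₑ ^ p * μ s := by
  rw [← lintegral_indicator_const hs]
  refine lintegral_congr fun x => ?_
  by_cases hx : x ∈ s <;> simp [hx, hp]

variable [hp : Fact (p ∈ Set.Ioo (0 : ℝ) 1)]

/-- The distance from the `n`-th indicator to the limit is `‖c‖ ^ p` times the measure of the
remainder, which tends to `0` by continuity from above, as the union has finite measure. -/
theorem IndicatorMem.iUnion (hS : IsClosed (S : Set (LpSpace 𝕜 p I))) {s : ℕ → Set ℝ}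
    (hs : ∀ n, IndicatorMem S c (s n)) (hm : ∀ n, MeasurableSet (s n)) (hmono : Monotone s)
    (hfin : volume.restrict I (⋃ n, s n) ≠ (⊤ : ℝ≥0∞)) : IndicatorMem S c (⋃ n, s n) := by
  have hmU := MeasurableSet.iUnion hm
  have hU := memLp_indicator_const (ENNReal.ofReal p) hmU c (Or.inr hfin)
  choose h hS' using hs
  refine ⟨hU, hS.mem_of_tendsto (f := fun n => ofFun _ (h n)) (b := atTop) ?_
    (Eventually.of_forall hS')⟩
  have hlim : Tendsto (fun n => volume.restrict I ((⋃ n, s n) \ s n)) atTop (𝓝 0) := by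
    have := tendsto_measure_iInter_atTop (μ := volume.restrict I)
      (s := fun n => (⋃ n, s n) \ s n)
      (fun n => (hmU.diff (hm n)).nullMeasurableSet)
      (fun m n hmn => Set.sdiff_subset_sdiff_right (hmono hmn))
      ⟨0, measure_ne_top_of_subset Set.sdiff_subset hfin⟩
    rwa [← Set.sdiff_iUnion, Set.sdiff_self, measure_empty] at this
  rw [tendsto_iff_edist_tendsto_0]
  have hlim' : Tendsto (fun n => ‖c‖ₑ ^ p * volume.restrict I ((⋃ n, s n) \ s n)) atTop (𝓝 0) := by
    have := ENNReal.Tendsto.const_mul (a := ‖c‖ₑ ^ p) hlim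
      (Or.inr (ENNReal.rpow_ne_top_of_nonneg hp.out.1.le enorm_ne_top))
    rwa [mul_zero] at this
  refine hlim'.congr fun n => ?_
  rw [edist_comm, edist_eq_enorm_sub, ← ofFun_sub, enorm_ofFun,
    ← lintegral_indicator_const_rpow hp.out.1 _ (hmU.diff (hm n)),
    Set.indicator_sdiff (Set.subset_iUnion s n)]

/-- A closed subgroup of `L^p(I)` that contains the step functions is everything. -/
theorem eq_top_of_indicator_Ico_mem (hS : IsClosed (S : Set (LpSpace 𝕜 p I)))
    (hIco : ∀ (c : 𝕜) (a b : ℝ), a ≤ b → IndicatorMem S c (Set.Ico a b)) : S = ⊤ := by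
  -- Dynkin's π-λ argument, on sets cut down to `[-N, N)` so that all measures are finite. The
  -- generators `Iio a` become half-open intervals or the empty set.
  have hbdd : ∀ (c : 𝕜) (N : ℝ) (s : Set ℝ), MeasurableSet s →
      IndicatorMem S c (s ∩ Set.Ico (-N) N) := by
    intro c N
    rcases le_or_gt 0 N with hN | hN
    swap
    · intro s _
      rw [Set.Ico_eq_empty (by linarith), Set.inter_empty]
      exact IndicatorMem.empty
    refine MeasurableSpace.induction_on_inter
      (C := fun s _ => IndicatorMem S c (s ∩ Set.Ico (-N) N))
      (BorelSpace.measurable_eq.trans (borel_eq_generateFrom_Iio ℝ)) isPiSystem_Iio ?_ ?_ ?_ ?_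
    · rw [Set.empty_inter]
      exact IndicatorMem.empty
    · rintro _ ⟨a, rfl⟩
      rw [Set.inter_comm, Set.Ico_inter_Iio]
      rcases le_or_gt (-N) (min N a) with h | h
      · exact hIco c _ _ h
      · rw [Set.Ico_eq_empty h.not_gt]
        exact IndicatorMem.empty
    · intro t _ ht
      have : tᶜ ∩ Set.Ico (-N) N = Set.Ico (-N) N \ (t ∩ Set.Ico (-N) N) := by
        ext x
        simp only [Set.mem_inter_iff, Set.mem_compl_iff, Set.mem_sdiff]
        tauto
      rw [this]
      exact (hIco c _ _ (by linarith)).diff ht Set.inter_subset_right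
    · intro f hd hm hf
      -- The disjoint union is rewritten as an increasing union of finite unions, to which
      -- `IndicatorMem.iUnion` applies.
      have e : (⋃ i, f i) ∩ Set.Ico (-N) N = ⋃ n, ⋃ i < n, f i ∩ Set.Ico (-N) N := by
        ext x
        simp only [Set.mem_inter_iff, Set.mem_iUnion, exists_prop]
        exact ⟨fun ⟨⟨i, hi⟩, hx⟩ => ⟨i + 1, i, i.lt_succ_self, hi, hx⟩,
          fun ⟨_, i, _, hi, hx⟩ => ⟨⟨i, hi⟩, hx⟩⟩
      rw [e]
      refine IndicatorMem.iUnion hS (fun n => ?_)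
        (fun n => MeasurableSet.biUnion (Set.to_countable _) fun i _ =>
          (hm i).inter measurableSet_Ico)
        (fun m n hmn => Set.biUnion_subset_biUnion_left fun i hi => lt_of_lt_of_le hi hmn) ?_
      · induction n with
        | zero => simpa using IndicatorMem.empty
        | succ n ih =>
          rw [Set.biUnion_lt_succ]
          refine ih.union (hf n) (Set.disjoint_iUnion₂_left.2 fun i hi => ?_)
          exact (hd hi.ne).mono Set.inter_subset_left Set.inter_subset_left
      · rw [← e]
        refine ne_top_of_le_ne_top ?_
          ((Measure.restrict_apply_le _ _).trans (measure_mono Set.inter_subset_right))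
        simp
  have hfin : ∀ (c : 𝕜) (s : Set ℝ), MeasurableSet s → volume.restrict I s < (⊤ : ℝ≥0∞) →
      IndicatorMem S c s := by
    intro c s hs hμ
    have e : s = ⋃ n : ℕ, s ∩ Set.Ico (-(n : ℝ)) n := by
      rw [← Set.inter_iUnion]
      refine (Set.inter_eq_left.2 fun x _ => ?_).symm
      obtain ⟨n, hn⟩ := exists_nat_gt |x|
      exact Set.mem_iUnion.2 ⟨n, (abs_lt.1 hn).1.le, (abs_lt.1 hn).2⟩
    rw [e] at hμ ⊢
    refine IndicatorMem.iUnion hS (fun n => hbdd c n s hs)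
      (fun n => hs.inter measurableSet_Ico) (fun m n hmn => ?_) hμ.ne
    have : (m : ℝ) ≤ n := by exact_mod_cast hmn
    exact Set.inter_subset_inter_right _ (Set.Ico_subset_Ico (neg_le_neg this) this)
  refine (AddSubgroup.eq_top_iff' S).2 fun f => ?_
  rw [← SetLike.mem_coe, ← hS.closure_eq, EMetric.mem_closure_iff]
  intro ε hε
  -- The density lemma yields `≤` for the quasi-norm. The intermediate `δ < ε` restores strictness,
  -- and the tolerance `δ ^ p⁻¹` becomes `δ` after taking `p`-th powers.
  obtain ⟨δ, hδ0, hδ⟩ := exists_between hε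
  obtain ⟨g, hg, hgm, hgS⟩ := MemLp.induction_dense (μ := volume.restrict I)
    (ENNReal.ofReal_ne_top (r := p))
    (fun g : ℝ → 𝕜 => ∃ h : MemLp g (ENNReal.ofReal p) (volume.restrict I), ofFun g h ∈ S)
    (fun c s hs hμ ε _ => ⟨s.indicator fun _ => c, by simp, hfin c s hs hμ⟩)
    (fun f g ⟨hf, hfS⟩ ⟨hg, hgS⟩ => ⟨hf.add hg, by
      rw [ofFun_add hf hg]; exact S.add_mem hfS hgS⟩)
    (fun f ⟨hf, _⟩ => hf.1) f.memLp_fn (ε := δ ^ p⁻¹)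
    (by simp [hδ0.ne', hp.out.1, hp.out.1.le])
  refine ⟨ofFun g hgm, hgS, ?_⟩
  rw [edist_eq_enorm_sub, ← ofFun_fn f, ← ofFun_sub, enorm_ofFun,
    ← eLpNorm_ofReal_rpow hp.out.1]
  refine (ENNReal.rpow_le_rpow hg hp.out.1.le).trans_lt ?_
  rwa [← ENNReal.rpow_mul, inv_mul_cancel₀ hp.out.1.ne', ENNReal.rpow_one]

end LpSpace

/-! ### Smooth steps with small derivatives -/

theorem lintegral_enorm_add_rpow_le {E : Type*} [NormedAddCommGroup E]
    {p : ℝ} (h0 : 0 ≤ p) (h1 : p ≤ 1) {f g : ℝ → E} (hf : Continuous f) :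
    ∫⁻ x, ‖f x + g x‖ₑ ^ p ≤ (∫⁻ x, ‖f x‖ₑ ^ p) + ∫⁻ x, ‖g x‖ₑ ^ p := by
  rw [← lintegral_add_left' ((hf.enorm.measurable.pow_const p).aemeasurable)]
  refine lintegral_mono fun x => ?_
  exact (ENNReal.rpow_le_rpow (enorm_add_le _ _) h0).trans (ENNReal.rpow_add_le_add_rpow _ _ h0 h1)

/-- The difference of two translates, times a constant. -/
theorem lintegral_enorm_mul_sub_translate_rpow_le {𝕜 : Type*} [RCLike 𝕜] {p : ℝ} (h0 : 0 ≤ p)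
    (h1 : p ≤ 1) {F : ℝ → 𝕜} (hF : Continuous F) (c : 𝕜) (a b : ℝ) :
    ∫⁻ x, ‖c * (F (x - a) - F (x - b))‖ₑ ^ p ≤ ‖c‖ₑ ^ p * (2 * ∫⁻ x, ‖F x‖ₑ ^ p) := by
  simp_rw [enorm_mul, ENNReal.mul_rpow_of_nonneg _ _ h0]
  rw [lintegral_const_mul' _ _ (ENNReal.rpow_ne_top_of_nonneg h0 enorm_ne_top)]
  gcongr
  simp_rw [sub_eq_add_neg (F _)]
  refine (lintegral_enorm_add_rpow_le h0 h1 (by fun_prop)).trans ?_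
  simp_rw [enorm_neg]
  rw [lintegral_sub_right_eq_self (fun x => ‖F x‖ₑ ^ p),
    lintegral_sub_right_eq_self (fun x => ‖F x‖ₑ ^ p), two_mul]

theorem iteratedDeriv_mul_sub_translate {𝕜 : Type*} [RCLike 𝕜] {u : ℝ → 𝕜}
    (hu : ContDiff ℝ ∞ u) (i : ℕ) (c : 𝕜) (a b : ℝ) :
    iteratedDeriv i (fun x => c * (u (x - a) - u (x - b))) =
      fun x => c * (iteratedDeriv i u (x - a) - iteratedDeriv i u (x - b)) := by
  have hu' : ContDiff ℝ i u := hu.of_le (by exact_mod_cast le_top)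
  have hs : ∀ a, ContDiff ℝ i fun x => u (x - a) := fun a =>
    hu'.comp (contDiff_id.sub contDiff_const)
  ext x
  rw [iteratedDeriv_const_mul c ((hs a).sub (hs b)).contDiffAt,
    iteratedDeriv_fun_sub (hs a).contDiffAt (hs b).contDiffAt,
    iteratedDeriv_comp_sub_const, iteratedDeriv_comp_sub_const]

/-- A function bounded by `M` and vanishing off a set of measure at most `m`. -/
theorem lintegral_enorm_rpow_le_of_support {E : Type*} [NormedAddCommGroup E] {p : ℝ} (h0 : 0 < p)
    {f : ℝ → E} {A : Set ℝ} (hA : MeasurableSet A) {M : ℝ≥0∞} (hM : ∀ x, ‖f x‖ₑ ≤ M)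
    (hf : ∀ x, x ∉ A → f x = 0) : ∫⁻ x, ‖f x‖ₑ ^ p ≤ M ^ p * volume A := by
  rw [← lintegral_indicator_const hA]
  refine lintegral_mono fun x => ?_
  by_cases hx : x ∈ A
  · simpa [hx] using ENNReal.rpow_le_rpow (hM x) h0.le
  · simp [hx, hf x hx, h0]

/-- Induction on `k`, replacing a step `u` of width `a` by its moving average `v` over a window of
length `a`. Since `v' = a⁻¹ * (u - u(· - a))` is at most `2 / a` and lives on `[0, 2a]`, the
integral of `|v'| ^ p` is at most `4 * a ^ (1 - p)`, small because `p < 1`. Higher derivatives of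
`v` are controlled by those of `u`. -/
theorem exists_smooth_step (𝕜 : Type*) [RCLike 𝕜] {p : ℝ} (hp : p ∈ Set.Ioo (0 : ℝ) 1) (k : ℕ) :
    ∀ {ε η : ℝ}, 0 < ε → 0 < η → ∃ u : ℝ → 𝕜, ContDiff ℝ ∞ u ∧ (∀ x ≤ 0, u x = 0) ∧
      (∀ x, η ≤ x → u x = 1) ∧ (∀ x, ‖u x‖ ≤ 1) ∧
      ∀ i < k, ∫⁻ x, ‖iteratedDeriv (i + 1) u x‖ₑ ^ p ≤ ENNReal.ofReal ε := by
  obtain ⟨h0, h1⟩ := hp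
  induction k with
  | zero =>
    intro ε η _ hη
    refine ⟨fun x => (Real.smoothTransition (x / η) : 𝕜), ?_, fun x hx => ?_, fun x hx => ?_,
      fun x => ?_, by simp⟩
    · exact (RCLike.ofRealCLM (K := 𝕜)).contDiff.comp
        (Real.smoothTransition.contDiff.comp (contDiff_id.div_const η))
    · simp [Real.smoothTransition.zero_of_nonpos (div_nonpos_of_nonpos_of_nonneg hx hη.le)]
    · simp [Real.smoothTransition.one_of_one_le ((one_le_div hη).2 hx)]
    · rw [RCLike.norm_ofReal, abs_of_nonneg (Real.smoothTransition.nonneg _)]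
      exact Real.smoothTransition.le_one _
  | succ k ih =>
    intro ε η hε hη
    -- The average reaches `1` at `2 * a`, and `4 * a ^ (1 - p)` will bound the first derivative.
    obtain ⟨a, ha, haη, haε⟩ : ∃ a : ℝ, 0 < a ∧ 2 * a ≤ η ∧ 4 * a ^ (1 - p) ≤ ε := by
      have h1p : 0 < 1 - p := by linarith
      refine ⟨min (η / 2) ((ε / 4) ^ (1 - p)⁻¹), by positivity, ?_, ?_⟩
      · linarith [min_le_left (η / 2) ((ε / 4) ^ (1 - p)⁻¹)]
      · have := Real.rpow_le_rpow (by positivity)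
          (min_le_right (η / 2) ((ε / 4) ^ (1 - p)⁻¹)) h1p.le
        rw [← Real.rpow_mul (by positivity), inv_mul_cancel₀ h1p.ne', Real.rpow_one] at this
        linarith
    -- As `a` is fixed before `u`, the tolerance can absorb the factor `2 * a ^ (-p)` that averaging
    -- puts on the higher derivatives.
    obtain ⟨u, hu, hu0, hu1, hub, huk⟩ := ih (ε := ε * a ^ p / 2) (η := a) (by positivity) ha
    have hint : ∀ x y, IntervalIntegrable u volume x y := fun x y =>
      hu.continuous.intervalIntegrable x y
    set V : ℝ → 𝕜 := fun x => ∫ t in (0 : ℝ)..x, u t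
    have hV : ∀ x, HasDerivAt V (u x) x := fun x =>
      intervalIntegral.integral_hasDerivAt_right (hint 0 x)
        (hu.continuous.stronglyMeasurableAtFilter _ _) hu.continuous.continuousAt
    set c : 𝕜 := ((a⁻¹ : ℝ) : 𝕜)
    set v : ℝ → 𝕜 := fun x => c * (V x - V (x - a))
    have hvint : ∀ x, v x = c * ∫ t in (x - a)..x, u t := fun x => by
      simp only [v, V]
      rw [intervalIntegral.integral_interval_sub_left (hint _ _) (hint _ _)]
    -- The form `x - 0` presents `v'` as a difference of two translates, as in
    -- `iteratedDeriv_mul_sub_translate`.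
    have hv : ∀ x, HasDerivAt v (c * (u (x - 0) - u (x - a))) x := fun x => by
      rw [sub_zero]
      exact ((hV x).sub ((hV (x - a)).comp_sub_const x a)).const_mul c
    have hv' : deriv v = fun x => c * (u (x - 0) - u (x - a)) := funext fun x => (hv x).deriv
    have hca : c * (a : 𝕜) = 1 := by
      rw [← RCLike.ofReal_mul, inv_mul_cancel₀ ha.ne', RCLike.ofReal_one]
    have hcnorm : ‖c‖ = a⁻¹ := by
      rw [RCLike.norm_ofReal, abs_of_pos (inv_pos.2 ha)]
    have hcp : ‖c‖ₑ ^ p = ENNReal.ofReal (a ^ p)⁻¹ := by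
      rw [← ofReal_norm, hcnorm, ENNReal.ofReal_rpow_of_nonneg (by positivity) h0.le,
        Real.inv_rpow ha.le]
    refine ⟨v, ?_, fun x hx => ?_, fun x hx => ?_, fun x => ?_, fun i hi => ?_⟩
    · refine contDiff_infty_iff_deriv.2 ⟨fun x => (hv x).differentiableAt, ?_⟩
      rw [hv']
      fun_prop
    · rw [hvint, intervalIntegral.integral_congr (g := fun _ => 0), intervalIntegral.integral_zero,
        mul_zero]
      intro t ht
      rw [Set.uIcc_of_le (by linarith)] at ht
      exact hu0 t (ht.2.trans hx)
    · rw [hvint, intervalIntegral.integral_congr (g := fun _ => 1), intervalIntegral.integral_const,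
        sub_sub_cancel, RCLike.real_smul_eq_coe_mul, mul_one, hca]
      intro t ht
      rw [Set.uIcc_of_le (by linarith)] at ht
      exact hu1 t (by linarith [ht.1])
    · rw [hvint, norm_mul, hcnorm]
      have := intervalIntegral.norm_integral_le_of_norm_le_const (a := x - a) (b := x) (C := 1)
        (f := u) fun t _ => hub t
      rw [sub_sub_cancel, one_mul, abs_of_pos ha] at this
      calc a⁻¹ * ‖∫ t in (x - a)..x, u t‖ ≤ a⁻¹ * a := by gcongr
        _ = 1 := inv_mul_cancel₀ ha.ne'
    · rw [iteratedDeriv_succ', hv', iteratedDeriv_mul_sub_translate hu]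
      cases i with
      | zero =>
        simp only [iteratedDeriv_zero]
        refine (lintegral_enorm_rpow_le_of_support h0 (A := Set.Icc 0 (2 * a)) measurableSet_Icc
          (M := ‖c‖ₑ * 2) (fun x => ?_) fun x hx => ?_).trans ?_
        · rw [enorm_mul]
          gcongr
          rw [← ofReal_norm]
          refine (ENNReal.ofReal_le_ofReal
            ((norm_sub_le _ _).trans (add_le_add (hub _) (hub _)))).trans ?_
          norm_num
        · rw [Set.mem_Icc, not_and_or, not_le, not_le] at hx
          rcases hx with hx | hx
          · rw [hu0 _ (by linarith), hu0 _ (by linarith), sub_self, mul_zero]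
          · rw [hu1 _ (by linarith), hu1 _ (by linarith), sub_self, mul_zero]
        · rw [ENNReal.mul_rpow_of_nonneg _ _ h0.le, hcp, Real.volume_Icc, sub_zero]
          have h2 : (2 : ℝ≥0∞) ^ p ≤ ENNReal.ofReal 2 := by
            rw [ENNReal.ofReal_ofNat]
            exact (ENNReal.rpow_le_rpow_of_exponent_le one_le_two h1.le).trans_eq
              (ENNReal.rpow_one 2)
          refine (mul_le_mul_left (mul_le_mul_right h2 _) _).trans ?_
          rw [← ENNReal.ofReal_mul (by positivity), ← ENNReal.ofReal_mul (by positivity)]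
          refine ENNReal.ofReal_le_ofReal (le_trans (le_of_eq ?_) haε)
          rw [Real.rpow_sub ha, Real.rpow_one]
          ring
      | succ j =>
        refine (lintegral_enorm_mul_sub_translate_rpow_le h0.le h1.le
          (hu.continuous_iteratedDeriv _ (by exact_mod_cast le_top)) c 0 a).trans ?_
        rw [hcp]
        have := huk j (by omega)
        refine (mul_le_mul_right (mul_le_mul_right this _) _).trans ?_
        rw [← ENNReal.ofReal_ofNat, ← ENNReal.ofReal_mul (by positivity),
          ← ENNReal.ofReal_mul (by positivity)]
        refine ENNReal.ofReal_le_ofReal (le_of_eq ?_)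
        have : 0 < a ^ p := Real.rpow_pos_of_pos ha p
        field_simp

variable {𝕜 : Type*} [RCLike 𝕜] {k : ℕ} {p : ℝ} {I : Set ℝ}

namespace PreSobolev

/-! ### Approximation by test functions with prescribed derivatives -/

/-- A test function as an element of the space of test functions. -/
def mk (f : ℝ → 𝕜) (h : ContDiff ℝ ∞ f) (hc : HasCompactSupport f) : PreSobolev 𝕜 k p I :=
  Subtype.mk (p := (· ∈ testFunctions 𝕜)) f ⟨h, hc⟩

@[simp]
theorem toFun_mk (f : ℝ → 𝕜) (h : ContDiff ℝ ∞ f) (hc : HasCompactSupport f) :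
    (mk f h hc : PreSobolev 𝕜 k p I).toFun = f :=
  rfl

theorem toFun_derivative (f : PreSobolev 𝕜 (k + 1) p I) : f.derivative.toFun = deriv f.toFun :=
  rfl

theorem toFun_sub (f g : PreSobolev 𝕜 k p I) : (f - g).toFun = f.toFun - g.toFun :=
  rfl

theorem restrict_add (f g : PreSobolev 𝕜 k p I) : (f + g).restrict = f.restrict + g.restrict :=
  rfl

theorem restrict_smul (c : 𝕜) (f : PreSobolev 𝕜 k p I) : (c • f).restrict = c • f.restrict :=
  rfl

theorem derivative_add (f g : PreSobolev 𝕜 (k + 1) p I) :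
    (f + g).derivative = f.derivative + g.derivative := by
  refine Subtype.ext (funext fun x => ?_)
  exact deriv_add (f.contDiff.differentiable (by simp) x) (g.contDiff.differentiable (by simp) x)

theorem derivative_smul (c : 𝕜) (f : PreSobolev 𝕜 (k + 1) p I) :
    (c • f).derivative = c • f.derivative := by
  refine Subtype.ext (funext fun x => ?_)
  exact deriv_const_smul c (f.contDiff.differentiable (by simp) x)

variable [hp : Fact (p ∈ Set.Ioo (0 : ℝ) 1)]

theorem enorm_eq_sum (f : PreSobolev 𝕜 k p I) :
    ‖f‖ₑ = ∑ i ∈ Finset.range (k + 1), ∫⁻ x in I, ‖iteratedDeriv i f.toFun x‖ₑ ^ p := by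
  rw [← ofReal_norm, norm_def, quasiNorm_rpow hp.out.1,
    ENNReal.ofReal_sum_of_nonneg fun i _ => by positivity]
  refine Finset.sum_congr rfl fun i _ => ?_
  have hm := f.memLp_iteratedDeriv i (ENNReal.ofReal p)
  rw [ENNReal.toReal_rpow, eLpNorm_ofReal_rpow hp.out.1, ENNReal.ofReal_toReal]
  exact ((memLp_ofReal_iff hp.out.1).1 hm).2.ne

theorem enorm_restrict (f : PreSobolev 𝕜 k p I) :
    ‖f.restrict‖ₑ = ∫⁻ x in I, ‖f.toFun x‖ₑ ^ p :=
  LpSpace.enorm_ofFun (f.memLp (ENNReal.ofReal p))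

theorem enorm_eq_restrict_add_derivative (f : PreSobolev 𝕜 (k + 1) p I) :
    ‖f‖ₑ = ‖f.restrict‖ₑ + ‖f.derivative‖ₑ := by
  rw [enorm_eq_sum, Finset.sum_range_succ', enorm_eq_sum, enorm_restrict, add_comm]
  simp_rw [iteratedDeriv_succ', iteratedDeriv_zero, toFun_derivative]

theorem norm_eq_restrict_add_derivative (f : PreSobolev 𝕜 (k + 1) p I) :
    ‖f‖ = ‖f.restrict‖ + ‖f.derivative‖ := by
  have := congrArg ENNReal.toReal (enorm_eq_restrict_add_derivative f)
  rwa [ENNReal.toReal_add enorm_ne_top enorm_ne_top, toReal_enorm, toReal_enorm,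
    toReal_enorm] at this

theorem norm_eq_restrict (f : PreSobolev 𝕜 0 p I) : ‖f‖ = ‖f.restrict‖ := by
  have : ‖f‖ₑ = ‖f.restrict‖ₑ := by
    rw [enorm_eq_sum, enorm_restrict]
    simp
  simpa using congrArg ENNReal.toReal this

theorem norm_restrict_le (f : PreSobolev 𝕜 k p I) : ‖f.restrict‖ ≤ ‖f‖ := by
  have : ‖f.restrict‖ₑ ≤ ‖f‖ₑ := by
    rw [enorm_eq_sum, enorm_restrict, Finset.sum_range_succ']
    simp
  simpa using ENNReal.toReal_mono enorm_ne_top this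

theorem enorm_le_of_lintegral_iteratedDeriv_le (f : PreSobolev 𝕜 k p I) {B : ℝ≥0∞}
    (h : ∀ i < k + 1, ∫⁻ x, ‖iteratedDeriv i f.toFun x‖ₑ ^ p ≤ B) :
    ‖f‖ₑ ≤ ((k + 1 : ℕ) : ℝ≥0∞) * B := by
  rw [enorm_eq_sum]
  refine (Finset.sum_le_card_nsmul _ _ B fun i hi => ?_).trans_eq (by simp)
  exact (setLIntegral_le_lintegral _ _).trans (h i (Finset.mem_range.1 hi))

/-- A step function is approximated by test functions with small derivatives. -/
theorem exists_approx_indicator (c : 𝕜) {a b : ℝ} (hab : a ≤ b)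
    (hm : MemLp ((Set.Ico a b).indicator fun _ => c) (ENNReal.ofReal p) (volume.restrict I))
    {t : ℝ} (ht : 0 < t) :
    ∃ f : PreSobolev 𝕜 (k + 1) p I,
      ‖f.restrict - LpSpace.ofFun _ hm‖ₑ ≤ (‖c‖ₑ * 3) ^ p * (2 * ENNReal.ofReal t) ∧
      ‖f.derivative‖ₑ ≤ ((k + 1 : ℕ) : ℝ≥0∞) * (‖c‖ₑ ^ p * (2 * ENNReal.ofReal t)) := by
  obtain ⟨h0, h1⟩ := hp.out
  -- The number `t` serves both as width of the step and as bound for its derivatives. Orders `1` to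
  -- `k + 1` of `u` are needed, being orders `0` to `k` of the derivative.
  obtain ⟨u, hu, hu0, hu1, hub, huk⟩ := exists_smooth_step 𝕜 hp.out (k + 1) ht ht
  set F : ℝ → 𝕜 := fun x => c * (u (x - a) - u (x - b))
  have hF : ContDiff ℝ ∞ F := by fun_prop
  have hFc : HasCompactSupport F := by
    refine HasCompactSupport.intro (K := Set.Icc a (b + t)) isCompact_Icc fun x hx => ?_
    rw [Set.mem_Icc, not_and_or, not_le, not_le] at hx
    rcases hx with hx | hx
    · simp only [F]
      rw [hu0 _ (by linarith), hu0 _ (by linarith), sub_self, mul_zero]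
    · simp only [F]
      rw [hu1 _ (by linarith), hu1 _ (by linarith), sub_self, mul_zero]
  refine ⟨mk F hF hFc, ?_, ?_⟩
  · refine (LpSpace.enorm_ofFun (MemLp.sub
      ((mk F hF hFc : PreSobolev 𝕜 (k + 1) p I).memLp _) hm)).trans_le ?_
    refine (setLIntegral_le_lintegral _ _).trans ?_
    -- `F` differs from the indicator only on the two transition intervals, of total length at most
    -- `2 * t`, and there by at most `2‖c‖ + ‖c‖`.
    refine (lintegral_enorm_rpow_le_of_support h0 (A := Set.Icc a (a + t) ∪ Set.Icc b (b + t))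
      (measurableSet_Icc.union measurableSet_Icc) (M := ‖c‖ₑ * 3) (fun x => ?_)
      fun x hx => ?_).trans ?_
    · have he : ∀ y, ‖u y‖ₑ ≤ 1 := fun y => by
        rw [← ofReal_norm]
        exact ENNReal.ofReal_le_one.2 (hub y)
      rw [Pi.sub_apply, toFun_mk]
      refine (enorm_sub_le (a := F x)).trans ?_
      have h2 : ‖F x‖ₑ ≤ ‖c‖ₑ * (1 + 1) := by
        rw [enorm_mul]
        gcongr
        exact enorm_sub_le.trans (add_le_add (he _) (he _))
      have h3 : ‖(Set.Ico a b).indicator (fun _ => c) x‖ₑ ≤ ‖c‖ₑ :=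
        enorm_indicator_le_enorm_self _ _
      refine (add_le_add h2 h3).trans_eq ?_
      ring
    · rw [Set.mem_union, not_or, Set.mem_Icc, Set.mem_Icc, not_and_or, not_and_or, not_le, not_le,
        not_le, not_le] at hx
      rw [Pi.sub_apply, toFun_mk]
      simp only [F]
      obtain ⟨hxa, hxb⟩ := hx
      rcases hxa with hxa | hxa
      · rw [hu0 _ (by linarith), hu0 _ (by linarith), Set.indicator_of_notMem
          (fun h => hxa.not_ge h.1)]
        simp
      · rcases hxb with hxb | hxb
        · rw [hu1 _ (by linarith), hu0 _ (by linarith), Set.indicator_of_mem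
            (show x ∈ Set.Ico a b from ⟨by linarith, hxb⟩)]
          simp
        · rw [hu1 _ (by linarith), hu1 _ (by linarith), Set.indicator_of_notMem
            (fun h => absurd h.2 (by linarith))]
          simp
    · gcongr
      refine (measure_union_le _ _).trans ?_
      simp [two_mul]
  · refine enorm_le_of_lintegral_iteratedDeriv_le _ fun i hi => ?_
    rw [toFun_derivative, toFun_mk, ← iteratedDeriv_succ', iteratedDeriv_mul_sub_translate hu]
    refine (lintegral_enorm_mul_sub_translate_rpow_le h0.le h1.le
      (hu.continuous_iteratedDeriv _ (by exact_mod_cast le_top)) c a b).trans ?_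
    gcongr
    exact huk i hi

/-- Up to a small error, every test function is the derivative of a test function. -/
theorem exists_approx_derivative (h : PreSobolev 𝕜 k p I) :
    ∃ C : 𝕜, ∀ {t : ℝ}, 0 < t → ∃ f : PreSobolev 𝕜 (k + 1) p I,
      ‖f.derivative - h‖ₑ ≤ ((k + 1 : ℕ) : ℝ≥0∞) * (‖C‖ₑ ^ p * ENNReal.ofReal t) := by
  obtain ⟨h0, h1⟩ := hp.out
  obtain ⟨N, hN, hN0⟩ := h.hasCompactSupport.exists_pos_le_norm
  have hcont := h.contDiff.continuous
  -- This primitive vanishes to the left of `-N` but keeps the value `H N` to the right of `N`, so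
  -- it need not be compactly supported.
  set H : ℝ → 𝕜 := fun x => ∫ s in (-N)..x, h.toFun s
  have hH : ∀ x, HasDerivAt H (h.toFun x) x := fun x =>
    intervalIntegral.integral_hasDerivAt_right (hcont.intervalIntegrable _ _)
      (hcont.stronglyMeasurableAtFilter _ _) hcont.continuousAt
  have hHd : deriv H = h.toFun := funext fun x => (hH x).deriv
  have hH0 : ∀ x ≤ -N, H x = 0 := fun x hx => by
    refine (intervalIntegral.integral_congr (g := fun _ => 0) fun s hs => ?_).trans
      intervalIntegral.integral_zero
    rw [Set.uIcc_of_ge hx] at hs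
    refine hN0 s ?_
    rw [Real.norm_eq_abs, abs_of_nonpos (by linarith [hs.2])]
    linarith [hs.2]
  have hH1 : ∀ x, N ≤ x → H x = H N := fun x hx => by
    rw [← sub_eq_zero]
    simp only [H]
    rw [intervalIntegral.integral_interval_sub_left (hcont.intervalIntegrable _ _)
      (hcont.intervalIntegrable _ _)]
    refine (intervalIntegral.integral_congr (g := fun _ => 0) fun s hs => ?_).trans
      intervalIntegral.integral_zero
    rw [Set.uIcc_of_le hx] at hs
    refine hN0 s ?_
    rw [Real.norm_eq_abs]
    exact hs.1.trans (le_abs_self s)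
  have hHc : ContDiff ℝ ∞ H :=
    contDiff_infty_iff_deriv.2 ⟨fun x => (hH x).differentiableAt, by rw [hHd]; exact h.contDiff⟩
  refine ⟨H N, fun {t} ht => ?_⟩
  obtain ⟨u, hu, hu0, hu1, hub, huk⟩ := exists_smooth_step 𝕜 hp.out (k + 1) ht one_pos
  -- A smooth step of height `H N` removes the constant tail; the error in the derivative is `-H N *
  -- u'(x - N)`. The factor `H N` does not depend on `t`.
  set F : ℝ → 𝕜 := fun x => H x - H N * u (x - N)
  have hF : ContDiff ℝ ∞ F := by fun_prop
  have hFc : HasCompactSupport F := by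
    refine HasCompactSupport.intro (K := Set.Icc (-N) (N + 1)) isCompact_Icc fun x hx => ?_
    rw [Set.mem_Icc, not_and_or, not_le, not_le] at hx
    simp only [F]
    rcases hx with hx | hx
    · rw [hu0 _ (by linarith), hH0 x hx.le, mul_zero, sub_zero]
    · rw [hu1 _ (by linarith), hH1 x (by linarith), mul_one, sub_self]
  refine ⟨mk F hF hFc, enorm_le_of_lintegral_iteratedDeriv_le _ fun i hi => ?_⟩
  have hFd : deriv F - h.toFun = fun x => (-H N) * deriv u (x - N) := funext fun x => by
    have hd : HasDerivAt F (h.toFun x - H N * deriv u (x - N)) x :=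
      (hH x).sub ((((hu.differentiable (by simp) (x - N)).hasDerivAt).comp_sub_const x N).const_mul
        (H N))
    rw [Pi.sub_apply, hd.deriv]
    ring
  have hdu : ContDiff ℝ ∞ (deriv u) := (contDiff_infty_iff_deriv.1 hu).2
  have hdi : iteratedDeriv i (fun x => (-H N) * deriv u (x - N)) =
      fun x => (-H N) * iteratedDeriv (i + 1) u (x - N) := funext fun x => by
    have hdu' : ContDiff ℝ i fun x => deriv u (x - N) :=
      (hdu.comp (contDiff_id.sub contDiff_const)).of_le (by exact_mod_cast le_top)
    rw [iteratedDeriv_const_mul _ hdu'.contDiffAt, iteratedDeriv_comp_sub_const,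
      iteratedDeriv_succ']
  rw [toFun_sub, toFun_derivative, toFun_mk, hFd, hdi]
  simp_rw [enorm_mul, ENNReal.mul_rpow_of_nonneg _ _ h0.le, enorm_neg]
  rw [lintegral_const_mul' _ _ (ENNReal.rpow_ne_top_of_nonneg h0.le enorm_ne_top),
    lintegral_sub_right_eq_self (fun x => ‖iteratedDeriv (i + 1) u x‖ₑ ^ p)]
  gcongr
  exact huk i hi

/-- The map `f ↦ (f|_I, f')` on test functions. -/
noncomputable def restrictDerivative :
    PreSobolev 𝕜 (k + 1) p I →+ LpSpace 𝕜 p I × PreSobolev 𝕜 k p I where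
  toFun f := (f.restrict, f.derivative)
  map_zero' := Prod.ext rfl (by
    have := derivative_smul (0 : 𝕜) (0 : PreSobolev 𝕜 (k + 1) p I)
    rwa [zero_smul, zero_smul] at this)
  map_add' f g := Prod.ext rfl (derivative_add f g)

/-- Peetre's phenomenon: for `0 < p < 1` a function in `L^p(I)` and its derivative can be
approximated independently of each other. -/
theorem denseRange_restrictDerivative :
    DenseRange (restrictDerivative : PreSobolev 𝕜 (k + 1) p I →+ _) := by
  set G := (restrictDerivative : PreSobolev 𝕜 (k + 1) p I →+ _).range.topologicalClosure
  have hG : IsClosed (G : Set (LpSpace 𝕜 p I × PreSobolev 𝕜 k p I)) :=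
    AddSubgroup.isClosed_topologicalClosure _
  have hmem : ∀ f : PreSobolev 𝕜 (k + 1) p I, (f.restrict, f.derivative) ∈ G := fun f =>
    AddSubgroup.le_topologicalClosure _ ⟨f, rfl⟩
  have hlim : Tendsto (fun n : ℕ => ENNReal.ofReal (1 / ((n : ℝ) + 1))) atTop (𝓝 0) := by
    have := ENNReal.tendsto_ofReal tendsto_one_div_add_atTop_nhds_zero_nat
    rwa [ENNReal.ofReal_zero] at this
  have hlim' : ∀ K : ℝ≥0∞, K ≠ (⊤ : ℝ≥0∞) →
      Tendsto (fun n : ℕ => K * ENNReal.ofReal (1 / ((n : ℝ) + 1))) atTop (𝓝 0) := fun K hK => by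
    have := ENNReal.Tendsto.const_mul hlim (Or.inr hK)
    rwa [mul_zero] at this
  have hrp : ∀ x : ℝ≥0∞, x ≠ (⊤ : ℝ≥0∞) → x ^ p ≠ (⊤ : ℝ≥0∞) := fun x hx =>
    ENNReal.rpow_ne_top_of_nonneg hp.out.1.le hx
  -- The `g` with `(g, 0)` in the closure form a closed subgroup, which contains the step functions.
  have hS : G.comap (AddMonoidHom.inl (LpSpace 𝕜 p I) (PreSobolev 𝕜 k p I)) = ⊤ := by
    refine LpSpace.eq_top_of_indicator_Ico_mem
      (hG.preimage (Continuous.prodMk continuous_id continuous_const)) fun c a b hab => ?_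
    have hm : MemLp ((Set.Ico a b).indicator fun _ => c) (ENNReal.ofReal p)
        (volume.restrict I) :=
      memLp_indicator_const _ measurableSet_Ico c (Or.inr
        (ne_top_of_le_ne_top (by simp) (Measure.restrict_apply_le _ _)))
    refine ⟨hm, ?_⟩
    choose f hf hf' using fun n : ℕ =>
      exists_approx_indicator (k := k) c hab hm (Nat.one_div_pos_of_nat (α := ℝ) (n := n))
    change (LpSpace.ofFun _ hm, (0 : PreSobolev 𝕜 k p I)) ∈ G
    refine hG.mem_of_tendsto (f := fun n => ((f n).restrict, (f n).derivative)) (b := atTop) ?_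
      (Eventually.of_forall fun n => hmem _)
    refine Tendsto.prodMk_nhds ?_ ?_
    · rw [tendsto_iff_edist_tendsto_0]
      refine tendsto_of_tendsto_of_tendsto_of_le_of_le tendsto_const_nhds
        (hlim' ((‖c‖ₑ * 3) ^ p * 2) ?_) (fun _ => zero_le) fun n => ?_
      · exact ENNReal.mul_ne_top (hrp _ (ENNReal.mul_ne_top enorm_ne_top (by simp))) (by simp)
      · simpa only [edist_eq_enorm_sub, mul_assoc] using hf n
    · rw [tendsto_iff_edist_tendsto_0]
      refine tendsto_of_tendsto_of_tendsto_of_le_of_le tendsto_const_nhds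
        (hlim' (((k + 1 : ℕ) : ℝ≥0∞) * (‖c‖ₑ ^ p * 2)) ?_) (fun _ => zero_le) fun n => ?_
      · exact ENNReal.mul_ne_top (by simp) (ENNReal.mul_ne_top (hrp _ enorm_ne_top) (by simp))
      · simpa only [edist_eq_enorm_sub, sub_zero, mul_assoc] using hf' n
  have hinl : ∀ g : LpSpace 𝕜 p I, (g, (0 : PreSobolev 𝕜 k p I)) ∈ G := fun g => by
    have : g ∈ G.comap (AddMonoidHom.inl (LpSpace 𝕜 p I) (PreSobolev 𝕜 k p I)) := by
      rw [hS]
      trivial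
    exact this
  rintro ⟨g, h⟩
  obtain ⟨C, hC⟩ := exists_approx_derivative h
  choose f hf using fun n : ℕ => hC (Nat.one_div_pos_of_nat (α := ℝ) (n := n))
  -- The restriction of `f n` need not be controlled: adding `(g - f n, 0)`, already in the closure,
  -- corrects the first component exactly.
  have hGmem : ∀ n, (g, (f n).derivative) ∈ G := fun n => by
    have := G.add_mem (hinl (g - (f n).restrict)) (hmem (f n))
    rwa [Prod.mk_add_mk, sub_add_cancel, zero_add] at this
  change (g, h) ∈ G
  refine hG.mem_of_tendsto (f := fun n => (g, (f n).derivative)) (b := atTop)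
    (Tendsto.prodMk_nhds tendsto_const_nhds ?_) (Eventually.of_forall hGmem)
  rw [tendsto_iff_edist_tendsto_0]
  refine tendsto_of_tendsto_of_tendsto_of_le_of_le tendsto_const_nhds
    (hlim' (((k + 1 : ℕ) : ℝ≥0∞) * ‖C‖ₑ ^ p) ?_) (fun _ => zero_le) fun n => ?_
  · exact ENNReal.mul_ne_top (by simp) (hrp _ enorm_ne_top)
  · simpa only [edist_eq_enorm_sub, mul_assoc] using hf n

/-- First component of the density of pairs; the restriction map does not depend on the order `k` of
the quasi-norm. -/
theorem denseRange_restrict : DenseRange (restrict : PreSobolev 𝕜 k p I → LpSpace 𝕜 p I) := by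
  have h := (Prod.fst_surjective (α := LpSpace 𝕜 p I)
    (β := PreSobolev 𝕜 0 p I)).denseRange.comp (denseRange_restrictDerivative (k := 0))
    continuous_fst
  refine h.mono ?_
  rintro _ ⟨f, rfl⟩
  exact ⟨mk f.toFun f.contDiff f.hasCompactSupport, rfl⟩

end PreSobolev

/-! ### The canonical maps of the Sobolev space -/

open PreSobolev UniformSpace

variable [hp : Fact (p ∈ Set.Ioo (0 : ℝ) 1)]

theorem uniformContinuous_restrict :
    UniformContinuous (restrict : PreSobolev 𝕜 k p I → LpSpace 𝕜 p I) :=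
  (AddMonoidHomClass.lipschitz_of_bound
    (AddMonoidHom.mk' (restrict : PreSobolev 𝕜 k p I → LpSpace 𝕜 p I) restrict_add) 1
    fun f => by simpa using norm_restrict_le f).uniformContinuous

theorem uniformContinuous_derivative :
    UniformContinuous (derivative : PreSobolev 𝕜 (k + 1) p I → PreSobolev 𝕜 k p I) :=
  (AddMonoidHomClass.lipschitz_of_bound
    (AddMonoidHom.mk' (derivative : PreSobolev 𝕜 (k + 1) p I → _) derivative_add) 1
    fun f => by
      rw [one_mul, norm_eq_restrict_add_derivative f]
      exact le_add_of_nonneg_left (norm_nonneg _)).uniformContinuous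

theorem continuous_alpha : Continuous (alpha : SobolevSpace 𝕜 k p I → LpSpace 𝕜 p I) :=
  Completion.continuous_extension

theorem alpha_coe (f : PreSobolev 𝕜 k p I) : alpha (f : SobolevSpace 𝕜 k p I) = f.restrict :=
  Completion.extension_coe uniformContinuous_restrict f

theorem continuous_delta :
    Continuous (delta : SobolevSpace 𝕜 (k + 1) p I → SobolevSpace 𝕜 k p I) :=
  Completion.continuous_map

theorem delta_coe (f : PreSobolev 𝕜 (k + 1) p I) :
    delta (f : SobolevSpace 𝕜 (k + 1) p I) = (f.derivative : SobolevSpace 𝕜 k p I) :=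
  Completion.map_coe uniformContinuous_derivative f

theorem alpha_add (x y : SobolevSpace 𝕜 k p I) : alpha (x + y) = alpha x + alpha y := by
  refine Completion.induction_on₂ x y (isClosed_eq (continuous_alpha.comp continuous_add)
    ((continuous_alpha.comp continuous_fst).add (continuous_alpha.comp continuous_snd)))
    fun f g => ?_
  rw [← Completion.coe_add, alpha_coe, alpha_coe, alpha_coe, restrict_add]

theorem delta_add (x y : SobolevSpace 𝕜 (k + 1) p I) : delta (x + y) = delta x + delta y := by
  refine Completion.induction_on₂ x y (isClosed_eq (continuous_delta.comp continuous_add)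
    ((continuous_delta.comp continuous_fst).add (continuous_delta.comp continuous_snd)))
    fun f g => ?_
  rw [← Completion.coe_add, delta_coe, delta_coe, delta_coe, derivative_add, Completion.coe_add]

/-- The norm is homogeneous of degree `p`, not `1`, so continuity comes from `‖c • f‖ = ‖c‖ ^ p *
‖f‖`. It makes the identity in `alpha_smul` a closed condition. -/
theorem continuous_const_smul_lpSpace (c : 𝕜) : Continuous fun f : LpSpace 𝕜 p I => c • f := by
  refine AddMonoidHomClass.continuous_of_bound
    (DistribSMul.toAddMonoidHom (LpSpace 𝕜 p I) c) (‖c‖ ^ p) fun f => ?_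
  have : ‖c • f‖ₑ = ‖c‖ₑ ^ p * ‖f‖ₑ := by
    conv_lhs => rw [← LpSpace.ofFun_fn f, ← LpSpace.ofFun_const_smul, LpSpace.enorm_ofFun]
    rw [LpSpace.enorm_eq_lintegral, ← lintegral_const_mul' _ _
      (ENNReal.rpow_ne_top_of_nonneg hp.out.1.le enorm_ne_top)]
    simp_rw [Pi.smul_apply, enorm_smul, ENNReal.mul_rpow_of_nonneg _ _ hp.out.1.le]
  have h := congrArg ENNReal.toReal this
  rw [ENNReal.toReal_mul, ← ENNReal.toReal_rpow, toReal_enorm, toReal_enorm, toReal_enorm] at h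
  exact h.le

theorem alpha_smul (c : 𝕜) (x : SobolevSpace 𝕜 k p I) : alpha (c • x) = c • alpha x := by
  refine Completion.induction_on x (isClosed_eq (continuous_alpha.comp (continuous_const_smul c))
    ((continuous_const_smul_lpSpace c).comp continuous_alpha)) fun f => ?_
  rw [← Completion.coe_smul, alpha_coe, alpha_coe, restrict_smul]

theorem delta_smul (c : 𝕜) (x : SobolevSpace 𝕜 (k + 1) p I) : delta (c • x) = c • delta x := by
  refine Completion.induction_on x (isClosed_eq (continuous_delta.comp (continuous_const_smul c))
    (continuous_delta.const_smul c)) fun f => ?_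
  rw [← Completion.coe_smul, delta_coe, delta_coe, derivative_smul, Completion.coe_smul]

/-! ### Norm identities on the completion and the resulting linear homeomorphisms. -/

theorem norm_eq_alpha_add_delta (x : SobolevSpace 𝕜 (k + 1) p I) :
    ‖x‖ = ‖alpha x‖ + ‖delta x‖ := by
  refine Completion.induction_on x (isClosed_eq continuous_norm
    (continuous_alpha.norm.add continuous_delta.norm)) fun f => ?_
  rw [alpha_coe, delta_coe, Completion.norm_coe, Completion.norm_coe,
    norm_eq_restrict_add_derivative]

theorem norm_eq_norm_alpha (x : SobolevSpace 𝕜 0 p I) : ‖x‖ = ‖alpha x‖ := by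
  refine Completion.induction_on x (isClosed_eq continuous_norm continuous_alpha.norm) fun f => ?_
  rw [alpha_coe, Completion.norm_coe, norm_eq_restrict]

/-- A linear map from a complete space with two-sided norm estimates and dense range is onto. -/
theorem surjective_of_denseRange_of_bounds {E F : Type*} [NormedAddCommGroup E]
    [NormedAddCommGroup F] [Module 𝕜 E] [Module 𝕜 F] [CompleteSpace E] (f : E →ₗ[𝕜] F)
    (C D : NNReal) (hC : ∀ x, ‖f x‖ ≤ C * ‖x‖) (hD : ∀ x, ‖x‖ ≤ D * ‖f x‖)
    (hf : DenseRange f) : Function.Surjective f := by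
  have h := (AddMonoidHomClass.antilipschitz_of_bound f hD).isClosed_range
    (AddMonoidHomClass.lipschitz_of_bound f C hC).uniformContinuous
  exact Set.range_eq_univ.1 (h.closure_eq ▸ hf.closure_range)

/-- The linear map `x ↦ (α x, δ x)`. -/
noncomputable def alphaDelta :
    SobolevSpace 𝕜 (k + 1) p I →ₗ[𝕜] LpSpace 𝕜 p I × SobolevSpace 𝕜 k p I where
  toFun x := (alpha x, delta x)
  map_add' x y := Prod.ext (alpha_add x y) (delta_add x y)
  map_smul' c x := Prod.ext (alpha_smul c x) (delta_smul c x)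

theorem norm_alphaDelta_le (x : SobolevSpace 𝕜 (k + 1) p I) :
    ‖alphaDelta x‖ ≤ (1 : NNReal) * ‖x‖ := by
  rw [NNReal.coe_one, one_mul, norm_eq_alpha_add_delta]
  exact max_le (le_add_of_nonneg_right (norm_nonneg _)) (le_add_of_nonneg_left (norm_nonneg _))

theorem norm_le_norm_alphaDelta (x : SobolevSpace 𝕜 (k + 1) p I) :
    ‖x‖ ≤ (2 : NNReal) * ‖alphaDelta x‖ := by
  rw [norm_eq_alpha_add_delta, NNReal.coe_ofNat, two_mul]
  exact add_le_add (norm_fst_le (alphaDelta x)) (norm_snd_le (alphaDelta x))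

/-- Density of the pairs in `L^p(I)` times the test functions suffices, since test functions are
dense in their completion. -/
theorem denseRange_alphaDelta :
    DenseRange (alphaDelta : SobolevSpace 𝕜 (k + 1) p I →ₗ[𝕜] _) := by
  have h : DenseRange (Prod.map id (fun f : PreSobolev 𝕜 k p I => (f : SobolevSpace 𝕜 k p I)) :
      LpSpace 𝕜 p I × PreSobolev 𝕜 k p I → LpSpace 𝕜 p I × SobolevSpace 𝕜 k p I) :=
    DenseRange.prodMap denseRange_id Completion.denseRange_coe
  refine (h.comp denseRange_restrictDerivative
    (continuous_id.prodMap (Completion.continuous_coe _))).mono ?_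
  rintro _ ⟨f, rfl⟩
  exact ⟨f, Prod.ext (alpha_coe f) (delta_coe f)⟩

/-- The linear homeomorphism `x ↦ (α x, δ x)`. -/
noncomputable def alphaDeltaEquiv :
    SobolevSpace 𝕜 (k + 1) p I ≃L[𝕜] LpSpace 𝕜 p I × SobolevSpace 𝕜 k p I :=
  continuousLinearEquivOfBounds alphaDelta _ _ norm_alphaDelta_le norm_le_norm_alphaDelta
    (surjective_of_denseRange_of_bounds _ _ _ norm_alphaDelta_le norm_le_norm_alphaDelta
      denseRange_alphaDelta)

/-- The linear homeomorphism `α : W^{0,p}(I) → L^p(I)`. -/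
noncomputable def alphaEquiv : SobolevSpace 𝕜 0 p I ≃L[𝕜] LpSpace 𝕜 p I :=
  let A : SobolevSpace 𝕜 0 p I →ₗ[𝕜] LpSpace 𝕜 p I :=
    { toFun := alpha, map_add' := alpha_add, map_smul' := alpha_smul }
  have h₁ : ∀ x, ‖A x‖ ≤ (1 : NNReal) * ‖x‖ := fun x => by
    rw [NNReal.coe_one, one_mul]
    exact (norm_eq_norm_alpha x).ge
  have h₂ : ∀ x, ‖x‖ ≤ (1 : NNReal) * ‖A x‖ := fun x => by
    rw [NNReal.coe_one, one_mul]
    exact (norm_eq_norm_alpha x).le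
  continuousLinearEquivOfBounds A _ _ h₁ h₂ (surjective_of_denseRange_of_bounds A _ _ h₁ h₂ (by
    refine (denseRange_restrict (k := 0)).mono ?_
    rintro _ ⟨f, rfl⟩
    exact ⟨f, alpha_coe f⟩))

theorem nonempty_sobolevSpace_equiv_pi (k : ℕ) :
    Nonempty (SobolevSpace 𝕜 k p I ≃L[𝕜] (Fin (k + 1) → LpSpace 𝕜 p I)) := by
  induction k with
  | zero => exact ⟨alphaEquiv.trans (ContinuousLinearEquiv.funUnique (Fin 1) 𝕜 _).symm⟩
  | succ k ih =>
    obtain ⟨e⟩ := ih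
    exact ⟨(alphaDeltaEquiv.trans ((ContinuousLinearEquiv.refl 𝕜 _).prodCongr e)).trans
      (Fin.consEquivL 𝕜 fun _ : Fin (k + 2) => LpSpace 𝕜 p I)⟩

end PeetreSobolev

theorem theorem1 (𝕜 : Type*) [RCLike 𝕜] (k : ℕ) (p : ℝ) [Fact (p ∈ Set.Ioo (0 : ℝ) 1)]
    (I : Set ℝ) (hI : I.OrdConnected) :
    (∀ (x : PeetreSobolev.SobolevSpace 𝕜 (k + 1) p I)
        (f : ℕ → PeetreSobolev.PreSobolev 𝕜 (k + 1) p I), PeetreSobolev.Represents f x →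
          Tendsto (fun j => (f j).restrict) atTop (𝓝 (PeetreSobolev.alpha x)) ∧
          PeetreSobolev.Represents (fun j => (f j).derivative) (PeetreSobolev.delta x)) ∧
    (∃ Φ : PeetreSobolev.SobolevSpace 𝕜 (k + 1) p I ≃L[𝕜]
        PeetreSobolev.LpSpace 𝕜 p I × PeetreSobolev.SobolevSpace 𝕜 k p I,
      ∀ x, Φ x = (PeetreSobolev.alpha x, PeetreSobolev.delta x)) ∧
    Nonempty (PeetreSobolev.SobolevSpace 𝕜 (k + 1) p I ≃L[𝕜]
      (Fin (k + 2) → PeetreSobolev.LpSpace 𝕜 p I)) ∧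
    Nonempty (PeetreSobolev.SobolevSpace 𝕜 (k + 1) p I ≃L[𝕜] PeetreSobolev.LpSpace 𝕜 p I) := by
  obtain ⟨e⟩ := PeetreSobolev.nonempty_sobolevSpace_equiv_pi (𝕜 := 𝕜) (p := p) (I := I) (k + 1)
  obtain ⟨e'⟩ := PeetreSobolev.LpSpace.nonempty_pi_equiv (𝕜 := 𝕜) (p := p) hI (k + 1)
  refine ⟨fun x f hf => ⟨?_, ?_⟩, ⟨PeetreSobolev.alphaDeltaEquiv, fun _ => rfl⟩, ⟨e⟩,
    ⟨e.trans e'⟩⟩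
  -- Well-definedness on Cauchy sequences: the extensions are continuous and agree with restriction
  -- and differentiation on test functions.
  · exact ((PeetreSobolev.continuous_alpha.tendsto x).comp hf).congr fun j =>
      PeetreSobolev.alpha_coe (f j)
  · exact ((PeetreSobolev.continuous_delta.tendsto x).comp hf).congr fun j =>
      PeetreSobolev.delta_coe (f j)
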